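/- Let $A\ge 2$ and let $F_1,\dots,F_A$ be feedback functions: each $F_i:\{1,2,\dots\}\to(0,\infty)$ is given with a continuously differentiable extension $F_i:(0,\infty)\to(0,\infty)$ that is monotone (increasing or decreasing) on each interval $[n,n+1]$, $n\ge 1$. The generalized Pólya urn is the Markov chain $X(n)=(X_1(n),\dots,X_A(n))$ on vectors of non-negative integers (with the convention $F_i(0)=0$, and with the zero vector absorbing) that moves from $x$ to $x+e^{(i)}$, where $e^{(i)}$ is the $i$-th unit vector, with probability $F_i(x_i)/\sum_{j=1}^A F_j(x_j)$. Let $\Delta_{A-1}$ be the unit simplex in $\mathbb R^A$ and $\Delta^o_{A-1}$ the set of its points with all coordinates positive. For $\chi\in\Delta^o_{A-1}$ and $N\ge 1$ start the chain in $X_i(0)=\lfloor\chi_iN\rfloor$, $i=1,\dots,A$, and let $\mathrm{sMon}_i(\chi,N)=\{\lim_{n\to\infty}\sum_{j\ne i}X_j(n)<\infty\}$ be the event of a strong monopoly of agent $i$. The asymptotic attraction domain of agent $i$ is $$D_i=\Big\{\chi\in\Delta^o_{A-1}:\ \lim_{N\to\infty}\mathbb P(\mathrm{sMon}_i(\chi,N))=1\Big\}.$$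 Agent $i$ satisfies the monopoly condition (M) if $\sum_{k\ge1}1/F_i(k)<\infty$. An agent satisfying (M) is of type P if $\lim_{k\to\infty}F_i(k)\sum_{l\ge k}1/F_i(l)=\infty$, and of type E if $\limsup_{k\to\infty}F_i(k)\sum_{l\ge k}1/F_i(l)<\infty$. Suppose that at least one agent satisfies (M), that every agent satisfying (M) is of type P or of type E, and that one of the following holds: 1. At least one agent is of type E, and for all $\chi\in\Delta^o_{A-1}$ and all $i,j$, the equalities $\liminf_{N\to\infty}\frac{F_i(\chi_iN)}{F_j(\chi_jN)}=0$ and $\limsup_{N\to\infty}\frac{F_i(\chi_iN)}{F_j(\chi_jN)}=\infty$ do not hold simultaneously. 2. No agent is of type E, every agent of type P satisfies $\limsup_{k\to\infty}\frac1kF_i(k)\sum_{l\ge k}\frac1{F_i(l)}<\infty$, and for all $\chi\in\Delta^o_{A-1}$ and all $i,j$ the limit $\lim_{N\to\infty}\frac{F_i(\chi_iN)}{F_j(\chi_jN)}\in[0,\infty]$ exists. Then the attraction domains are, up to boundaries, polytopes that dissect the simplex: for every $i$ the closure $\overline{D_i}$ is a (possibly empty) polytope whose relative interior is contained in $D_i$;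 the sets $D_1,\dots,D_A$ are pairwise disjoint; and $$\bigcup_{i=1}^A\overline{D_i}=\Delta_{A-1}.$$ Moreover, $D_i=\emptyset$ for every agent $i$ that does not satisfy (M). -/

import Mathlib

open MeasureTheory ProbabilityTheory Filter Topology
open scoped ENNReal

namespace PolyaUrn

noncomputable section

/-- A feedback function `k ↦ f k > 0`, `k = 1, 2, …`, together with a continuously differentiable
extension to a positive function on `(0, ∞)` that is monotone (in either direction) on each
interval `[n, n + 1]`, `n = 1, 2, …`. The values of `f` on `(-∞, 0]` are never used. -/
structure IsFeedbackFunction (f : ℝ → ℝ) : Prop where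
  pos : ∀ x : ℝ, 0 < x → 0 < f x
  contDiffOn : ContDiffOn ℝ 1 f (Set.Ioi 0)
  monotone_or_antitone : ∀ n : ℕ, 1 ≤ n →
    MonotoneOn f (Set.Icc (n : ℝ) (n + 1)) ∨ AntitoneOn f (Set.Icc (n : ℝ) (n + 1))

/-- The monopoly condition `∑_{k ≥ 1} 1 / f k < ∞`. -/
def MonopolyCondition (f : ℝ → ℝ) : Prop :=
  Summable fun k : ℕ => 1 / f ((k + 1 : ℕ) : ℝ)

/-- `∑_{l ≥ k} 1 / f l`; only used under the monopoly condition. -/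
def tailSum (f : ℝ → ℝ) (k : ℕ) : ℝ :=
  ∑' l : ℕ, 1 / f ((k + l : ℕ) : ℝ)

/-- Type P: `f k * ∑_{l ≥ k} 1 / f l → ∞`. -/
def IsTypeP (f : ℝ → ℝ) : Prop :=
  MonopolyCondition f ∧ Tendsto (fun k : ℕ => f k * tailSum f k) atTop atTop

/-- Type E: `limsup_k f k * ∑_{l ≥ k} 1 / f l < ∞`. -/
def IsTypeE (f : ℝ → ℝ) : Prop :=
  MonopolyCondition f ∧
    limsup (fun k : ℕ => ENNReal.ofReal (f k * tailSum f k)) atTop < ∞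

/-- The growth bound `limsup_k (1 / k) * f k * ∑_{l ≥ k} 1 / f l < ∞`. -/
def GrowthBound (f : ℝ → ℝ) : Prop :=
  limsup (fun k : ℕ => ENNReal.ofReal (1 / (k : ℝ) * f k * tailSum f k)) atTop < ∞

variable {A : ℕ}

/-- The weight of agent `i` in state `x`, that is `F_i(x_i)`, with the convention `F_i(0) = 0`. -/
def weight (F : Fin A → ℝ → ℝ) (x : Fin A → ℕ) (i : Fin A) : ℝ≥0∞ :=
  if x i = 0 then 0 else ENNReal.ofReal (F i (x i))

/-- One step of the urn from state `x`: it moves to `x + e_i` with probability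
`F_i(x_i) / ∑_j F_j(x_j)`. A state of total weight `0` (for feedback functions, only the zero
state) is absorbing, so that the law is defined everywhere. -/
def stepLaw (F : Fin A → ℝ → ℝ) (x : Fin A → ℕ) : Measure (Fin A → ℕ) :=
  if ∑ j, weight F x j = 0 then Measure.dirac x
  else ∑ i, (weight F x i / ∑ j, weight F x j) • Measure.dirac (x + Pi.single i 1)

instance stepLaw_isProbabilityMeasure (F : Fin A → ℝ → ℝ) (x : Fin A → ℕ) :
    IsProbabilityMeasure (stepLaw F x) := by
  unfold stepLaw
  split_ifs with h
  · infer_instance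
  · constructor
    have htop : ∑ j, weight F x j ≠ ∞ := by
      refine ENNReal.sum_ne_top.2 fun j _ => ?_
      unfold weight
      split_ifs <;> simp
    simp only [Measure.coe_finsetSum, Finset.sum_apply, Measure.smul_apply, measure_univ,
      smul_eq_mul, mul_one]
    simp only [div_eq_mul_inv]
    rw [← Finset.sum_mul]
    exact ENNReal.mul_inv_cancel h htop

/-- The transition kernel of the urn on the (countable, discrete) state space `ℕ^A`. -/
def stepKernel (F : Fin A → ℝ → ℝ) : Kernel (Fin A → ℕ) (Fin A → ℕ) where
  toFun := stepLaw F
  measurable' := measurable_of_countable _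

instance stepKernel_isMarkovKernel (F : Fin A → ℝ → ℝ) : IsMarkovKernel (stepKernel F) :=
  ⟨fun x => stepLaw_isProbabilityMeasure F x⟩

/-- The transition kernel as a kernel from histories up to time `n`, which depends only on the
state at time `n`. -/
def historyKernel (F : Fin A → ℝ → ℝ) (n : ℕ) :
    Kernel ((i : Finset.Iic n) → (fun _ : ℕ => Fin A → ℕ) i) (Fin A → ℕ) :=
  (stepKernel F).comap (fun h => h ⟨n, Finset.mem_Iic.2 le_rfl⟩) (measurable_pi_apply _)

instance historyKernel_isMarkovKernel (F : Fin A → ℝ → ℝ) (n : ℕ) :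
    IsMarkovKernel (historyKernel F n) := by
  unfold historyKernel
  infer_instance

/-- The law, on the space of trajectories `(X(n))_{n ≥ 0}`, of the generalized Pólya urn started in
`X(0) = x₀`: the Markov chain with transition kernel `stepKernel F`. -/
def urnLaw (F : Fin A → ℝ → ℝ) (x₀ : Fin A → ℕ) : Measure (ℕ → Fin A → ℕ) :=
  Kernel.traj (X := fun _ : ℕ => Fin A → ℕ) (historyKernel F) 0 (fun _ => x₀)

/-- Strong monopoly of agent `i`: the limit of `∑_{j ≠ i} X_j(n)` as `n → ∞` is finite. -/
def strongMonopoly (i : Fin A) : Set (ℕ → Fin A → ℕ) :=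
  {X | ∃ L : ℕ, Tendsto (fun n => ∑ j ∈ Finset.univ.erase i, X n j) atTop (𝓝 L)}

/-- The initial state with market shares `χ` and market size `N`: `X_i(0) = ⌊χ_i N⌋`. -/
def initialState (χ : Fin A → ℝ) (N : ℕ) : Fin A → ℕ :=
  fun i => ⌊χ i * N⌋₊

/-- The (relative) interior of the unit simplex. -/
def openSimplex (A : ℕ) : Set (Fin A → ℝ) :=
  {χ | χ ∈ stdSimplex ℝ (Fin A) ∧ ∀ i, 0 < χ i}

/-- The asymptotic attraction domain `D_i`. -/
def attractionDomain (F : Fin A → ℝ → ℝ) (i : Fin A) : Set (Fin A → ℝ) :=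
  {χ | χ ∈ openSimplex A ∧
    Tendsto (fun N : ℕ => urnLaw F (initialState χ N) (strongMonopoly i)) atTop (𝓝 1)}

/-- The ratio `F_i(χ_i N) / F_j(χ_j N)`, as an element of `[0, ∞]`. -/
def feedbackRatio (F : Fin A → ℝ → ℝ) (χ : Fin A → ℝ) (i j : Fin A) (N : ℕ) : ℝ≥0∞ :=
  ENNReal.ofReal (F i (χ i * N) / F j (χ j * N))

/-- A polytope: the convex hull of finitely many points. -/
def IsPolytope (P : Set (Fin A → ℝ)) : Prop :=
  ∃ V : Finset (Fin A → ℝ), P = convexHull ℝ (V : Set (Fin A → ℝ))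

end

end PolyaUrn

/-! The proof rests on one cancellation. Give agent `i` the clock $S_i=\sum_{X_i(0)\le
l<X_i(n)}1/F_i(l)$. Agent `i` moves with probability proportional to $F_i(X_i)$ and its clock then
grows by $1/F_i(X_i)$, so all clocks have the same drift and $S_j-S_i$ is a martingale. Under (M)
the clock of `i` never exceeds its tail sum $T_i=\sum_{l\ge X_i(0)}1/F_i(l)$. Markov's inequality
then bounds the probability that `j` ever moves by $F_j(X_j(0))\,T_i$ (`measure_exists_le_mul_le`).
Chebyshev's inequality shows that `j` is unlikely to grow without bound when $T_i\le(1-\delta)T_j$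
and the sums of squares are negligible against $T_j^2$ (`measure_exists_le_le_of_sq`), as they are
for type P (`IsTypeP.eventually_sum_sq_le`).

Deciding who wins thus becomes a comparison of pairs of agents along rays. The ratio hypotheses hold
one ray at a time; Baire's theorem makes them uniform on an open subsector of any given sector
(`exists_sector_of_dichotomy`). A small rotation of the ray then turns a bounded comparison into a
decisive one. For type E the tail sums decay geometrically, so bounded becomes vanishing
(`IsTypeE.expBeats`). For type P with the growth bound a dilation by $1+\delta$ shrinks the tail sum
by a fixed factor $q<1$, which beats any loss smaller than $1/q$ in comparing the two tail sums
(`exists_tailBeats`). In the presence of type E every other agent loses at all shares, because a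
rival keeping pace with exponential growth would be of type E itself.

Hence for each pair of contenders there is a winner except on at most a hyperplane
$\chi_i=a_{ij}\chi_j$ with threshold $a_{ij}\ge0$. The winner has the smaller tail sum, so there are
no cycles, and off these hyperplanes one agent beats all the others. A nonempty $D_i$ lies between
the polytope $\{a_{ij}\chi_j\le\chi_i\}$ and its strict version in the open simplex (`dissection`).
-/

namespace PolyaUrn

/-! ### Markov property and sample paths of the urn -/

section Trajectories

variable {A : ℕ}

instance urnLaw_isProbabilityMeasure (F : Fin A → ℝ → ℝ) (x₀ : Fin A → ℕ) :
    IsProbabilityMeasure (urnLaw F x₀) := by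
  unfold urnLaw
  infer_instance

theorem lintegral_urnLaw_succ (F : Fin A → ℝ → ℝ) (x₀ : Fin A → ℕ) (n : ℕ)
    (g : (Fin A → ℕ) → (Fin A → ℕ) → ℝ≥0∞) :
    ∫⁻ X, g (X n) (X (n + 1)) ∂urnLaw F x₀ =
      ∫⁻ X, ∫⁻ y, g (X n) y ∂stepLaw F (X n) ∂urnLaw F x₀ := by
  have hg : Measurable (Function.uncurry g) := measurable_of_countable _
  have hg' : Measurable fun x => ∫⁻ y, g x y ∂stepLaw F x := measurable_of_countable _
  have key := Kernel.partialTraj_compProd_eq_map_traj (X := fun _ : ℕ => Fin A → ℕ)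
    (κ := historyKernel F) (Nat.zero_le n) (x₀ := fun _ => x₀)
  have hm : Measurable fun X : ℕ → Fin A → ℕ =>
      (Preorder.frestrictLe (π := fun _ : ℕ => Fin A → ℕ) n X, X (n + 1)) := by fun_prop
  have hG : Measurable fun p : ((i : Finset.Iic n) → (fun _ : ℕ => Fin A → ℕ) i) × (Fin A → ℕ) =>
      g (p.1 ⟨n, Finset.mem_Iic.2 le_rfl⟩) p.2 :=
    hg.comp (f := fun p : ((i : Finset.Iic n) → (fun _ : ℕ => Fin A → ℕ) i) × (Fin A → ℕ) =>
      (p.1 ⟨n, Finset.mem_Iic.2 le_rfl⟩, p.2)) (by fun_prop)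
  have h1 := lintegral_map (μ := urnLaw F x₀) hG hm
  have h2 : Measurable fun p : ((i : Finset.Iic n) → (fun _ : ℕ => Fin A → ℕ) i) =>
      ∫⁻ y, g (p ⟨n, Finset.mem_Iic.2 le_rfl⟩) y ∂stepLaw F (p ⟨n, Finset.mem_Iic.2 le_rfl⟩) :=
    hg'.comp (measurable_pi_apply _)
  refine h1.symm.trans ?_
  unfold urnLaw at *
  rw [← key, Measure.lintegral_compProd hG, ← Kernel.traj_map_frestrictLe_apply,
    lintegral_map (by exact h2) (Preorder.measurable_frestrictLe n)]
  rfl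

theorem ae_urnLaw_zero (F : Fin A → ℝ → ℝ) (x₀ : Fin A → ℕ) :
    ∀ᵐ X ∂urnLaw F x₀, X 0 = x₀ := by
  have h := Kernel.traj_map_frestrictLe_apply (X := fun _ : ℕ => Fin A → ℕ)
    (κ := historyKernel F) 0 0 (fun _ => x₀)
  rw [Kernel.partialTraj_self, Kernel.id_apply] at h
  have h2 : ∀ᵐ p ∂(Measure.dirac (fun _ => x₀) :
      Measure ((i : Finset.Iic 0) → (fun _ : ℕ => Fin A → ℕ) i)),
      p ⟨0, Finset.mem_Iic.2 le_rfl⟩ = x₀ := by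
    rw [ae_dirac_iff]
    exact measurable_pi_apply (X := fun _ : Finset.Iic 0 => Fin A → ℕ)
      (⟨0, Finset.mem_Iic.2 le_rfl⟩ : Finset.Iic 0) (measurableSet_singleton x₀)
  rw [← h] at h2
  exact ae_of_ae_map (Preorder.measurable_frestrictLe 0).aemeasurable h2

theorem ae_urnLaw_step (F : Fin A → ℝ → ℝ) (x₀ : Fin A → ℕ) (n : ℕ)
    {R : (Fin A → ℕ) → (Fin A → ℕ) → Prop} (hR : ∀ x, ∀ᵐ y ∂stepLaw F x, R x y) :
    ∀ᵐ X ∂urnLaw F x₀, R (X n) (X (n + 1)) := by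
  classical
  have h := lintegral_urnLaw_succ F x₀ n fun x y => if R x y then 0 else 1
  have h0 : ∀ x, ∫⁻ y, (if R x y then 0 else 1 : ℝ≥0∞) ∂stepLaw F x = 0 := by
    intro x
    rw [lintegral_eq_zero_iff (measurable_of_countable _)]
    filter_upwards [hR x] with y hy
    simp [hy]
  simp only [h0, lintegral_zero] at h
  have hm : Measurable fun X : ℕ → Fin A → ℕ =>
      (if R (X n) (X (n + 1)) then 0 else 1 : ℝ≥0∞) :=
    Measurable.comp (g := fun p : (Fin A → ℕ) × (Fin A → ℕ) =>
      (if R p.1 p.2 then 0 else 1 : ℝ≥0∞)) (f := fun X : ℕ → Fin A → ℕ => (X n, X (n + 1)))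
      (measurable_of_countable _) (by fun_prop)
  rw [lintegral_eq_zero_iff hm] at h
  filter_upwards [h] with X hX
  by_contra hc
  simp [hc] at hX

/-- The real-valued weight of agent `i` in state `x`. -/
noncomputable def realWeight (F : Fin A → ℝ → ℝ) (x : Fin A → ℕ) (i : Fin A) : ℝ :=
  if x i = 0 then 0 else F i (x i)

theorem weight_eq_ofReal (F : Fin A → ℝ → ℝ) (x : Fin A → ℕ) (i : Fin A) :
    weight F x i = ENNReal.ofReal (realWeight F x i) := by
  unfold weight realWeight
  split_ifs <;> simp

variable {F : Fin A → ℝ → ℝ}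

theorem realWeight_nonneg (hF : ∀ i x, 0 < x → 0 < F i x) (x : Fin A → ℕ) (i : Fin A) :
    0 ≤ realWeight F x i := by
  unfold realWeight
  split_ifs with h
  · rfl
  · exact (hF i _ (by positivity)).le

theorem sum_realWeight_pos (hF : ∀ i x, 0 < x → 0 < F i x) {x : Fin A → ℕ} {i : Fin A}
    (hi : x i ≠ 0) : 0 < ∑ k, realWeight F x k := by
  refine Finset.sum_pos' (fun k _ => realWeight_nonneg hF x k) ⟨i, Finset.mem_univ i, ?_⟩
  rw [realWeight, if_neg hi]
  exact hF i _ (by positivity)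

theorem sum_weight_eq (hF : ∀ i x, 0 < x → 0 < F i x) (x : Fin A → ℕ) :
    ∑ k, weight F x k = ENNReal.ofReal (∑ k, realWeight F x k) := by
  rw [ENNReal.ofReal_sum_of_nonneg fun k _ => realWeight_nonneg hF x k]
  exact Finset.sum_congr rfl fun k _ => weight_eq_ofReal F x k

theorem sum_weight_ne_zero (hF : ∀ i x, 0 < x → 0 < F i x) {x : Fin A → ℕ} {i : Fin A}
    (hi : x i ≠ 0) : ∑ k, weight F x k ≠ 0 := by
  rw [sum_weight_eq hF]
  simpa using sum_realWeight_pos hF hi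

theorem lintegral_stepLaw (hF : ∀ i x, 0 < x → 0 < F i x) {x : Fin A → ℕ} {i : Fin A}
    (hi : x i ≠ 0) {h : (Fin A → ℕ) → ℝ} (hh : ∀ y, 0 ≤ h y) :
    ∫⁻ y, ENNReal.ofReal (h y) ∂stepLaw F x =
      ENNReal.ofReal (h x + (∑ k, realWeight F x k * (h (x + Pi.single k 1) - h x)) /
        ∑ k, realWeight F x k) := by
  have hW := sum_realWeight_pos hF hi
  rw [stepLaw, if_neg (sum_weight_ne_zero hF hi)]
  simp only [lintegral_finsetSum_measure, lintegral_smul_measure, lintegral_dirac, smul_eq_mul]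
  rw [sum_weight_eq hF]
  have e : h x + (∑ k, realWeight F x k * (h (x + Pi.single k 1) - h x)) /
      ∑ k, realWeight F x k =
      ∑ k, realWeight F x k / (∑ k, realWeight F x k) * h (x + Pi.single k 1) := by
    have : ∀ k, realWeight F x k / (∑ k, realWeight F x k) * h (x + Pi.single k 1) =
        realWeight F x k * h (x + Pi.single k 1) / (∑ k, realWeight F x k) := fun k => by ring
    simp only [this, ← Finset.sum_div, mul_sub, Finset.sum_sub_distrib, ← Finset.sum_mul]
    field_simp
    ring
  rw [e, ENNReal.ofReal_sum_of_nonneg fun k _ =>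
    mul_nonneg (div_nonneg (realWeight_nonneg hF x k) hW.le) (hh _)]
  refine Finset.sum_congr rfl fun k _ => ?_
  rw [ENNReal.ofReal_mul (div_nonneg (realWeight_nonneg hF x k) hW.le), weight_eq_ofReal,
    ENNReal.ofReal_div_of_pos hW]

/-- A path that starts in `x₀` and increases exactly one coordinate by `1` in each step. -/
def IsUrnPath (x₀ : Fin A → ℕ) (X : ℕ → Fin A → ℕ) : Prop :=
  X 0 = x₀ ∧ ∀ n, ∃ k, X (n + 1) = X n + Pi.single k 1

theorem IsUrnPath.monotone {x₀ : Fin A → ℕ} {X : ℕ → Fin A → ℕ} (h : IsUrnPath x₀ X) :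
    Monotone X := by
  refine monotone_nat_of_le_succ fun n => ?_
  obtain ⟨k, hk⟩ := h.2 n
  rw [hk]
  exact le_add_of_nonneg_right (by simp)

theorem IsUrnPath.le {x₀ : Fin A → ℕ} {X : ℕ → Fin A → ℕ} (h : IsUrnPath x₀ X) (n : ℕ) :
    x₀ ≤ X n := h.1 ▸ h.monotone (Nat.zero_le n)

theorem IsUrnPath.sum_eq {x₀ : Fin A → ℕ} {X : ℕ → Fin A → ℕ} (h : IsUrnPath x₀ X) (n : ℕ) :
    ∑ k, X n k = ∑ k, x₀ k + n := by
  induction n with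
  | zero => simp [h.1]
  | succ n ih =>
    obtain ⟨k, hk⟩ := h.2 n
    simp [hk, Finset.sum_add_distrib, ih, add_assoc]

/-- A nonzero coordinate never returns to zero, so the absorbing zero state is not met and every
step moves exactly one agent. -/
theorem ae_isUrnPath (hF : ∀ i x, 0 < x → 0 < F i x) {x₀ : Fin A → ℕ} {i : Fin A}
    (hi : x₀ i ≠ 0) : ∀ᵐ X ∂urnLaw F x₀, IsUrnPath x₀ X := by
  have hs : ∀ n, ∀ᵐ X ∂urnLaw F x₀,
      X n i ≠ 0 → ∃ k, X (n + 1) = X n + Pi.single k 1 := by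
    intro n
    have hR : ∀ x : Fin A → ℕ, ∀ᵐ y ∂stepLaw F x, x i ≠ 0 → ∃ k, y = x + Pi.single k 1 := by
      intro x
      by_cases hx : x i = 0
      · exact Eventually.of_forall fun y h => absurd hx h
      · rw [stepLaw, if_neg (sum_weight_ne_zero hF hx), ae_iff]
        simp only [Measure.coe_finsetSum, Finset.sum_apply, Measure.smul_apply, smul_eq_mul]
        refine Finset.sum_eq_zero fun k _ => ?_
        rw [Measure.dirac_apply' _ (Set.to_countable _).measurableSet, Set.indicator_of_notMem,
          mul_zero]
        exact fun h => h fun _ => ⟨k, rfl⟩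
    exact ae_urnLaw_step F x₀ n hR
  filter_upwards [ae_urnLaw_zero F x₀, ae_all_iff.2 hs] with X h0 hX
  have hne : ∀ n, X n i ≠ 0 := by
    intro n
    induction n with
    | zero => rwa [h0]
    | succ n ih =>
      obtain ⟨k, hk⟩ := hX n ih
      rw [hk, Pi.add_apply]
      omega
  exact ⟨h0, fun n => hX n (hne n)⟩

/-- The event that `X_j` is unbounded. -/
def unboundedEvent (j : Fin A) : Set (ℕ → Fin A → ℕ) := {X | ∀ m, ∃ n, m ≤ X n j}

theorem IsUrnPath.mem_unboundedEvent {x₀ : Fin A → ℕ} {X : ℕ → Fin A → ℕ} (h : IsUrnPath x₀ X)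
    {i : Fin A} (hX : X ∈ strongMonopoly i) : X ∈ unboundedEvent i := by
  obtain ⟨L, hL⟩ := hX
  have hev : ∀ᶠ n in atTop, ∑ j ∈ Finset.univ.erase i, X n j = L := by
    simpa using hL
  obtain ⟨n₀, hn₀⟩ := eventually_atTop.1 hev
  intro m
  refine ⟨n₀ + m + L, ?_⟩
  have h1 := h.sum_eq (n₀ + m + L)
  rw [← Finset.add_sum_erase _ _ (Finset.mem_univ i), hn₀ _ (by omega)] at h1
  omega

theorem IsUrnPath.mem_strongMonopoly {x₀ : Fin A → ℕ} {X : ℕ → Fin A → ℕ} (h : IsUrnPath x₀ X)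
    {i : Fin A} (hX : ∀ j, j ≠ i → X ∉ unboundedEvent j) : X ∈ strongMonopoly i := by
  have hb : ∀ j, ∃ m, j ≠ i → ∀ n, X n j < m := by
    intro j
    by_cases hj : j = i
    · exact ⟨0, fun h => absurd hj h⟩
    · have := hX j hj
      simp only [unboundedEvent, Set.mem_ofPred_eq, not_forall, not_exists, not_le] at this
      obtain ⟨m, hm⟩ := this
      exact ⟨m, fun _ => hm⟩
  choose m hm using hb
  have hmono : Monotone fun n => ∑ j ∈ Finset.univ.erase i, X n j :=
    fun a b hab => Finset.sum_le_sum fun j _ => h.monotone hab j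
  have hbd : BddAbove (Set.range fun n => ∑ j ∈ Finset.univ.erase i, X n j) := by
    refine ⟨∑ j ∈ Finset.univ.erase i, m j, ?_⟩
    rintro _ ⟨n, rfl⟩
    exact Finset.sum_le_sum fun j hj => (hm j (Finset.ne_of_mem_erase hj) n).le
  exact ⟨_, tendsto_atTop_ciSup hmono hbd⟩

theorem strongMonopoly_notMem_unboundedEvent {X : ℕ → Fin A → ℕ} {i j : Fin A} (hij : j ≠ i)
    (hX : X ∈ strongMonopoly i) (hm : Monotone X) : X ∉ unboundedEvent j := by
  obtain ⟨L, hL⟩ := hX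
  have hev : ∀ᶠ n in atTop, ∑ j ∈ Finset.univ.erase i, X n j = L := by
    simpa using hL
  obtain ⟨n₀, hn₀⟩ := eventually_atTop.1 hev
  intro hu
  obtain ⟨n, hn⟩ := hu (L + 1)
  have h1 := hn₀ (max n n₀) (le_max_right _ _)
  have h2 : X (max n n₀) j ≤ ∑ j ∈ Finset.univ.erase i, X (max n n₀) j :=
    Finset.single_le_sum (f := fun j => X (max n n₀) j) (fun _ _ => Nat.zero_le _)
      (Finset.mem_erase.2 ⟨hij, Finset.mem_univ j⟩)
  have h3 : X n j ≤ X (max n n₀) j := hm (le_max_left n n₀) j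
  omega

/-- Coordinates are monotone along almost every path, so having reached `m` by time `n` means being
above `m` at time `n`. Fixed-time bounds therefore pass to all times without a maximal inequality.
-/
theorem measure_exists_le_le (hF : ∀ i x, 0 < x → 0 < F i x) {x₀ : Fin A → ℕ} {i : Fin A}
    (hi : x₀ i ≠ 0) (j : Fin A) (m : ℕ) {b : ℝ≥0∞}
    (hb : ∀ n, urnLaw F x₀ {X | m ≤ X n j} ≤ b) :
    urnLaw F x₀ {X | ∃ n, m ≤ X n j} ≤ b := by
  have hmono : Monotone fun n : ℕ => {X : ℕ → Fin A → ℕ | ∃ l ≤ n, m ≤ X l j} :=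
    fun a b hab X ⟨l, hl, h⟩ => ⟨l, hl.trans hab, h⟩
  have he : {X : ℕ → Fin A → ℕ | ∃ n, m ≤ X n j} = ⋃ n : ℕ, {X | ∃ l ≤ n, m ≤ X l j} := by
    ext X
    simp only [Set.mem_ofPred_eq, Set.mem_iUnion]
    exact ⟨fun ⟨n, h⟩ => ⟨n, n, le_rfl, h⟩, fun ⟨_, l, _, h⟩ => ⟨l, h⟩⟩
  rw [he, hmono.measure_iUnion]
  refine iSup_le fun n => (measure_mono_ae ?_).trans (hb n)
  filter_upwards [ae_isUrnPath hF hi] with X hX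
  rintro ⟨l, hl, h⟩
  exact h.trans (hX.monotone hl j)

end Trajectories

/-! ### Tail sums of the reciprocal feedback -/

section TailSums

variable {f : ℝ → ℝ}

theorem MonopolyCondition.summable (h : MonopolyCondition f) :
    Summable fun k : ℕ => 1 / f (k : ℝ) :=
  (summable_nat_add_iff 1).1 h

theorem MonopolyCondition.summable_add (h : MonopolyCondition f) (k : ℕ) :
    Summable fun l : ℕ => 1 / f ((k + l : ℕ) : ℝ) := by
  simpa only [add_comm k] using (summable_nat_add_iff (f := fun k : ℕ => 1 / f (k : ℝ)) k).2
    h.summable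

theorem tailSum_eq_sum_Ico_add (h : MonopolyCondition f) {k m : ℕ} (hkm : k ≤ m) :
    tailSum f k = ∑ l ∈ Finset.Ico k m, 1 / f (l : ℝ) + tailSum f m := by
  obtain ⟨d, rfl⟩ := Nat.exists_eq_add_of_le hkm
  have h1 := (h.summable_add k).sum_add_tsum_nat_add d
  rw [Finset.sum_Ico_eq_sum_range, Nat.add_sub_cancel_left]
  unfold tailSum
  rw [← h1]
  congr 1
  exact tsum_congr fun l => by rw [add_assoc, add_comm d l]

theorem tailSum_nonneg (hf : ∀ x, 0 < x → 0 < f x) {k : ℕ} (hk : 1 ≤ k) : 0 ≤ tailSum f k :=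
  tsum_nonneg fun l => one_div_nonneg.2 (hf _ (by positivity)).le

theorem sum_Ico_le_tailSum (h : MonopolyCondition f) (hf : ∀ x, 0 < x → 0 < f x) {k : ℕ}
    (hk : 1 ≤ k) (m : ℕ) : ∑ l ∈ Finset.Ico k m, 1 / f (l : ℝ) ≤ tailSum f k := by
  rcases le_total k m with hkm | hkm
  · rw [tailSum_eq_sum_Ico_add h hkm]
    have := tailSum_nonneg (f := f) hf (hk.trans hkm)
    linarith
  · rw [Finset.Ico_eq_empty_of_le hkm, Finset.sum_empty]
    exact tailSum_nonneg hf hk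

theorem tailSum_succ (h : MonopolyCondition f) (k : ℕ) :
    tailSum f k = 1 / f (k : ℝ) + tailSum f (k + 1) := by
  simpa using tailSum_eq_sum_Ico_add h (Nat.le_succ k)

theorem one_div_le_tailSum (h : MonopolyCondition f) (hf : ∀ x, 0 < x → 0 < f x) {k : ℕ}
    (hk : 1 ≤ k) : 1 / f (k : ℝ) ≤ tailSum f k := by
  rw [tailSum_succ h]
  have := tailSum_nonneg (f := f) hf (k := k + 1) (by omega)
  linarith

theorem tailSum_pos (h : MonopolyCondition f) (hf : ∀ x, 0 < x → 0 < f x) {k : ℕ}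
    (hk : 1 ≤ k) : 0 < tailSum f k :=
  (one_div_pos.2 (hf _ (by positivity))).trans_le (one_div_le_tailSum h hf hk)

theorem tailSum_anti (h : MonopolyCondition f) (hf : ∀ x, 0 < x → 0 < f x) {k m : ℕ}
    (hk : 1 ≤ k) (hkm : k ≤ m) : tailSum f m ≤ tailSum f k := by
  rw [tailSum_eq_sum_Ico_add h hkm]
  have : 0 ≤ ∑ l ∈ Finset.Ico k m, 1 / f (l : ℝ) :=
    Finset.sum_nonneg fun l hl => one_div_nonneg.2 (hf _ (by
      have := (Finset.mem_Ico.1 hl).1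
      have : 0 < l := by omega
      positivity)).le
  linarith

theorem exists_lt_sum_Ico (h : MonopolyCondition f) (k : ℕ) {c : ℝ} (hc : c < tailSum f k) :
    ∃ m, c < ∑ l ∈ Finset.Ico k m, 1 / f (l : ℝ) := by
  have h1 := (h.summable_add k).hasSum.tendsto_sum_nat
  obtain ⟨n, hn⟩ := (h1.eventually (lt_mem_nhds hc)).exists
  refine ⟨k + n, ?_⟩
  rwa [Finset.sum_Ico_eq_sum_range, Nat.add_sub_cancel_left]

theorem exists_lt_sum_Ico_of_not_monopolyCondition (h : ¬ MonopolyCondition f)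
    (hf : ∀ x, 0 < x → 0 < f x) {k : ℕ} (hk : 1 ≤ k) (c : ℝ) :
    ∃ m, c < ∑ l ∈ Finset.Ico k m, 1 / f (l : ℝ) := by
  have h0 : ¬ Summable fun l : ℕ => 1 / f ((k + l : ℕ) : ℝ) := by
    intro hs
    refine h ((summable_nat_add_iff (f := fun n : ℕ => 1 / f (n : ℝ)) 1).2
      ((summable_nat_add_iff (f := fun n : ℕ => 1 / f (n : ℝ)) k).1 ?_))
    simpa only [add_comm k] using hs
  have h1 := (not_summable_iff_tendsto_nat_atTop_of_nonneg (f := fun l : ℕ =>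
    1 / f ((k + l : ℕ) : ℝ)) fun l => one_div_nonneg.2 (hf _ (by positivity)).le).1 h0
  obtain ⟨n, hn⟩ := (h1.eventually (eventually_gt_atTop c)).exists
  refine ⟨k + n, ?_⟩
  rwa [Finset.sum_Ico_eq_sum_range, Nat.add_sub_cancel_left]

end TailSums

/-! ### First and second moments of the clock difference -/

section Moments

variable {A : ℕ} {F : Fin A → ℝ → ℝ}

/-- A martingale argument without integrability: comparing two nonnegative functions of equal
nonnegative drift keeps every integral in `[0, ∞]`, where the increments can be added without
subtraction. The drift is multiplied by the total weight, which is the same on both sides. -/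
theorem lintegral_urnLaw_eq_of_drift_eq (hF : ∀ i x, 0 < x → 0 < F i x) {x₀ : Fin A → ℕ}
    {i : Fin A} (hi : x₀ i ≠ 0) {h₁ h₂ r : (Fin A → ℕ) → ℝ} (h₁0 : ∀ x, 0 ≤ h₁ x)
    (h₂0 : ∀ x, 0 ≤ h₂ x) (hr : ∀ x, x₀ ≤ x → 0 ≤ r x)
    (hd₁ : ∀ x, x₀ ≤ x → ∑ k, realWeight F x k * (h₁ (x + Pi.single k 1) - h₁ x) = r x)
    (hd₂ : ∀ x, x₀ ≤ x → ∑ k, realWeight F x k * (h₂ (x + Pi.single k 1) - h₂ x) = r x)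
    (h₀ : h₁ x₀ = h₂ x₀) (n : ℕ) :
    ∫⁻ X, ENNReal.ofReal (h₁ (X n)) ∂urnLaw F x₀ =
      ∫⁻ X, ENNReal.ofReal (h₂ (X n)) ∂urnLaw F x₀ := by
  have step : ∀ (h : (Fin A → ℕ) → ℝ), (∀ x, 0 ≤ h x) →
      (∀ x, x₀ ≤ x → ∑ k, realWeight F x k * (h (x + Pi.single k 1) - h x) = r x) → ∀ n,
      ∫⁻ X, ENNReal.ofReal (h (X (n + 1))) ∂urnLaw F x₀ =
        ∫⁻ X, ENNReal.ofReal (h (X n)) ∂urnLaw F x₀ +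
        ∫⁻ X, ENNReal.ofReal (r (X n) / ∑ k, realWeight F (X n) k) ∂urnLaw F x₀ := by
    intro h h0 hd n
    have hm : Measurable fun X : ℕ → Fin A → ℕ => ENNReal.ofReal (h (X n)) :=
      Measurable.comp (g := fun x => ENNReal.ofReal (h x)) (measurable_of_countable _)
        (measurable_pi_apply n)
    rw [lintegral_urnLaw_succ F x₀ n fun _ y => ENNReal.ofReal (h y), ← lintegral_add_left hm]
    refine lintegral_congr_ae ?_
    filter_upwards [ae_isUrnPath hF hi] with X hX
    have hx : X n i ≠ 0 := by
      have : x₀ i ≤ X n i := hX.le n i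
      omega
    rw [lintegral_stepLaw hF hx h0, hd _ (hX.le n), ENNReal.ofReal_add (h0 _)
      (div_nonneg (hr _ (hX.le n)) (sum_realWeight_pos hF hx).le)]
  induction n with
  | zero =>
    refine lintegral_congr_ae ?_
    filter_upwards [ae_urnLaw_zero F x₀] with X hX
    rw [hX, h₀]
  | succ n ih => rw [step h₁ h₁0 hd₁, step h₂ h₂0 hd₂, ih]

theorem realWeight_mul_one_div (hF : ∀ i x, 0 < x → 0 < F i x) {x : Fin A → ℕ} {i : Fin A}
    (hi : x i ≠ 0) : realWeight F x i * (1 / F i (x i)) = 1 := by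
  rw [realWeight, if_neg hi, mul_one_div_cancel]
  exact (hF i _ (by positivity)).ne'

theorem sum_realWeight_mul_sum_Ico_sub (x₀ x : Fin A → ℕ) (hx : x₀ ≤ x) (i : Fin A)
    (c : ℕ → ℝ) :
    ∑ k, realWeight F x k * (∑ l ∈ Finset.Ico (x₀ i) ((x + Pi.single k 1 : Fin A → ℕ) i), c l -
      ∑ l ∈ Finset.Ico (x₀ i) (x i), c l) = realWeight F x i * c (x i) := by
  rw [Finset.sum_eq_single i]
  · rw [Pi.add_apply, Pi.single_eq_same, Finset.sum_Ico_succ_top (hx i)]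
    ring
  · intro k _ hk
    rw [Pi.add_apply, Pi.single_eq_of_ne hk.symm, add_zero, sub_self, mul_zero]
  · simp

/-- Both clocks have weighted drift `1` and start at `0`, so their expectations agree at each time.
That of agent `i` is at most its tail sum, and Markov's inequality applies to the clock of `j`,
which is at least `c` once `X_j` has reached `m`. -/
theorem measure_exists_le_mul_le (hF : ∀ i x, 0 < x → 0 < F i x) {x₀ : Fin A → ℕ}
    {i j : Fin A} (hi : x₀ i ≠ 0) (hj : x₀ j ≠ 0) (hM : MonopolyCondition (F i)) {m : ℕ} {c : ℝ}
    (hc : 0 < c) (hm : c ≤ ∑ l ∈ Finset.Ico (x₀ j) m, 1 / F j (l : ℝ)) :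
    urnLaw F x₀ {X | ∃ n, m ≤ X n j} ≤ ENNReal.ofReal (tailSum (F i) (x₀ i) / c) := by
  refine measure_exists_le_le hF hi j m fun n => ?_
  have hnn : ∀ (k : Fin A) (hk : x₀ k ≠ 0) (x : ℕ),
      0 ≤ ∑ l ∈ Finset.Ico (x₀ k) x, 1 / F k (l : ℝ) := fun k hk x =>
    Finset.sum_nonneg fun l hl => one_div_nonneg.2 (hF k _ (by
      have := (Finset.mem_Ico.1 hl).1
      have : 0 < l := by omega
      positivity)).le
  have hdrift : ∀ k : Fin A, x₀ k ≠ 0 → ∀ x : Fin A → ℕ, x₀ ≤ x →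
      ∑ k', realWeight F x k' *
        (∑ l ∈ Finset.Ico (x₀ k) ((x + Pi.single k' 1 : Fin A → ℕ) k), 1 / F k (l : ℝ) -
        ∑ l ∈ Finset.Ico (x₀ k) (x k), 1 / F k (l : ℝ)) = 1 := fun k hk x hx => by
    rw [sum_realWeight_mul_sum_Ico_sub x₀ x hx k fun l => 1 / F k (l : ℝ)]
    refine realWeight_mul_one_div hF ?_
    have : x₀ k ≤ x k := hx k
    omega
  have heq := lintegral_urnLaw_eq_of_drift_eq hF hi
    (h₁ := fun x => ∑ l ∈ Finset.Ico (x₀ j) (x j), 1 / F j (l : ℝ))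
    (h₂ := fun x => ∑ l ∈ Finset.Ico (x₀ i) (x i), 1 / F i (l : ℝ))
    (fun x => hnn j hj _) (fun x => hnn i hi _) (r := fun _ => 1) (fun _ _ => zero_le_one)
    (hdrift j hj) (hdrift i hi) (by simp) n
  have hle : ∫⁻ X, ENNReal.ofReal (∑ l ∈ Finset.Ico (x₀ i) (X n i), 1 / F i (l : ℝ))
      ∂urnLaw F x₀ ≤ ENNReal.ofReal (tailSum (F i) (x₀ i)) := by
    refine (lintegral_mono (g := fun _ => ENNReal.ofReal (tailSum (F i) (x₀ i)))
      fun X => ENNReal.ofReal_le_ofReal ?_).trans (by simp)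
    exact sum_Ico_le_tailSum hM (hF i) (by omega) _
  have hmeas : Measurable fun X : ℕ → Fin A → ℕ =>
      ENNReal.ofReal (∑ l ∈ Finset.Ico (x₀ j) (X n j), 1 / F j (l : ℝ)) :=
    Measurable.comp (g := fun x : Fin A → ℕ =>
      ENNReal.ofReal (∑ l ∈ Finset.Ico (x₀ j) (x j), 1 / F j (l : ℝ)))
      (measurable_of_countable _) (measurable_pi_apply n)
  have hmk := meas_ge_le_lintegral_div (μ := urnLaw F x₀) hmeas.aemeasurable
    (ε := ENNReal.ofReal c) (by simpa using hc) ENNReal.ofReal_ne_top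
  rw [heq] at hmk
  rw [ENNReal.ofReal_div_of_pos hc]
  refine le_trans (measure_mono fun X hX => ?_) (hmk.trans (ENNReal.div_le_div_right hle _))
  refine ENNReal.ofReal_le_ofReal (hm.trans ?_)
  refine Finset.sum_le_sum_of_subset_of_nonneg (Finset.Ico_subset_Ico_right hX)
    fun l hl _ => one_div_nonneg.2 (hF j _ ?_).le
  have := (Finset.mem_Ico.1 hl).1
  have : 0 < l := by omega
  positivity

/-- The clock difference has mean square equal to the expected sum of the squared clock steps. If
`X_j` reaches `m`, the clock of `j` exceeds that of `i` by at least `d`, since the latter is capped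
by its tail sum; Chebyshev's inequality concludes. -/
theorem measure_exists_le_le_of_sq (hF : ∀ i x, 0 < x → 0 < F i x) {x₀ : Fin A → ℕ}
    {i j : Fin A} (hij : i ≠ j) (hi : x₀ i ≠ 0) (hj : x₀ j ≠ 0) (hM : MonopolyCondition (F i))
    {v w : ℝ} (hv : ∀ m, ∑ l ∈ Finset.Ico (x₀ i) m, (1 / F i (l : ℝ)) ^ 2 ≤ v)
    (hw : ∀ m, ∑ l ∈ Finset.Ico (x₀ j) m, (1 / F j (l : ℝ)) ^ 2 ≤ w) {m : ℕ} {d : ℝ}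
    (hd : 0 < d)
    (hm : tailSum (F i) (x₀ i) + d ≤ ∑ l ∈ Finset.Ico (x₀ j) m, 1 / F j (l : ℝ)) :
    urnLaw F x₀ {X | ∃ n, m ≤ X n j} ≤ ENNReal.ofReal ((v + w) / d ^ 2) := by
  refine measure_exists_le_le hF hi j m fun n => ?_
  have hpos : ∀ (k : Fin A) (hk : x₀ k ≠ 0) (l : ℕ), x₀ k ≤ l → 0 < F k (l : ℝ) :=
    fun k hk l hl => hF k _ (by
      have : 0 < l := by omega
      positivity)
  have hdrift : ∀ k : Fin A, x₀ k ≠ 0 → ∀ x : Fin A → ℕ, x₀ ≤ x →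
      realWeight F x k * (1 / F k (x k)) = 1 := fun k hk x hx => by
    refine realWeight_mul_one_div hF ?_
    have : x₀ k ≤ x k := hx k
    omega
  have heq := lintegral_urnLaw_eq_of_drift_eq hF hi
    (h₁ := fun x => (∑ l ∈ Finset.Ico (x₀ j) (x j), 1 / F j (l : ℝ) -
      ∑ l ∈ Finset.Ico (x₀ i) (x i), 1 / F i (l : ℝ)) ^ 2)
    (h₂ := fun x => ∑ l ∈ Finset.Ico (x₀ i) (x i), (1 / F i (l : ℝ)) ^ 2 +
      ∑ l ∈ Finset.Ico (x₀ j) (x j), (1 / F j (l : ℝ)) ^ 2)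
    (fun x => sq_nonneg _) (fun x => add_nonneg (Finset.sum_nonneg fun _ _ => sq_nonneg _)
      (Finset.sum_nonneg fun _ _ => sq_nonneg _))
    (r := fun x => 1 / F i (x i) + 1 / F j (x j))
    (fun x hx => add_nonneg (one_div_nonneg.2 (hpos i hi _ (hx i)).le)
      (one_div_nonneg.2 (hpos j hj _ (hx j)).le))
    (fun x hx => by
      have h1 := hdrift i hi x hx
      have h2 := hdrift j hj x hx
      -- With `D` the clock difference, a move of `j` contributes `2 D + 1 / F j` to the weighted
      -- drift of `D ^ 2` and a move of `i` contributes `-2 D + 1 / F i`; the terms in `D` cancel.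
      rw [Finset.sum_eq_add i j hij]
      · simp only [Pi.add_apply, Pi.single_eq_same, Pi.single_eq_of_ne hij,
          Pi.single_eq_of_ne hij.symm, add_zero, Finset.sum_Ico_succ_top (hx i),
          Finset.sum_Ico_succ_top (hx j)]
        linear_combination (-2 * (∑ l ∈ Finset.Ico (x₀ j) (x j), 1 / F j (l : ℝ) -
          ∑ l ∈ Finset.Ico (x₀ i) (x i), 1 / F i (l : ℝ)) + 1 / F i (x i)) * h1 +
          (2 * (∑ l ∈ Finset.Ico (x₀ j) (x j), 1 / F j (l : ℝ) -
          ∑ l ∈ Finset.Ico (x₀ i) (x i), 1 / F i (l : ℝ)) + 1 / F j (x j)) * h2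
      · intro k _ hk
        simp only [Pi.add_apply, Pi.single_eq_of_ne hk.1.symm, Pi.single_eq_of_ne hk.2.symm,
          add_zero, sub_self, mul_zero]
      · simp
      · simp)
    (fun x hx => by
      simp only [add_sub_add_comm, mul_add, Finset.sum_add_distrib]
      rw [sum_realWeight_mul_sum_Ico_sub x₀ x hx i fun l => (1 / F i (l : ℝ)) ^ 2,
        sum_realWeight_mul_sum_Ico_sub x₀ x hx j fun l => (1 / F j (l : ℝ)) ^ 2]
      linear_combination (1 / F i (x i)) * hdrift i hi x hx +
        (1 / F j (x j)) * hdrift j hj x hx) (by simp) n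
  have hle : ∫⁻ X, ENNReal.ofReal (∑ l ∈ Finset.Ico (x₀ i) (X n i), (1 / F i (l : ℝ)) ^ 2 +
      ∑ l ∈ Finset.Ico (x₀ j) (X n j), (1 / F j (l : ℝ)) ^ 2)
      ∂urnLaw F x₀ ≤ ENNReal.ofReal (v + w) := by
    refine (lintegral_mono (g := fun _ => ENNReal.ofReal (v + w))
      fun X => ENNReal.ofReal_le_ofReal ?_).trans (by simp)
    exact add_le_add (hv _) (hw _)
  have hmeas : Measurable fun X : ℕ → Fin A → ℕ =>
      ENNReal.ofReal ((∑ l ∈ Finset.Ico (x₀ j) (X n j), 1 / F j (l : ℝ) -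
        ∑ l ∈ Finset.Ico (x₀ i) (X n i), 1 / F i (l : ℝ)) ^ 2) :=
    Measurable.comp (g := fun x : Fin A → ℕ =>
      ENNReal.ofReal ((∑ l ∈ Finset.Ico (x₀ j) (x j), 1 / F j (l : ℝ) -
        ∑ l ∈ Finset.Ico (x₀ i) (x i), 1 / F i (l : ℝ)) ^ 2))
      (measurable_of_countable _) (measurable_pi_apply n)
  have hmk := meas_ge_le_lintegral_div (μ := urnLaw F x₀) hmeas.aemeasurable
    (ε := ENNReal.ofReal (d ^ 2)) (by simpa using by positivity) ENNReal.ofReal_ne_top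
  rw [heq] at hmk
  rw [ENNReal.ofReal_div_of_pos (by positivity)]
  refine le_trans (measure_mono fun X hX => ?_) (hmk.trans (ENNReal.div_le_div_right hle _))
  have h1 : ∑ l ∈ Finset.Ico (x₀ j) m, 1 / F j (l : ℝ) ≤
      ∑ l ∈ Finset.Ico (x₀ j) (X n j), 1 / F j (l : ℝ) :=
    Finset.sum_le_sum_of_subset_of_nonneg (Finset.Ico_subset_Ico_right hX)
      fun l hl _ => one_div_nonneg.2 (hpos j hj l (Finset.mem_Ico.1 hl).1).le
  have h2 := sum_Ico_le_tailSum hM (hF i) (k := x₀ i) (by omega) (X n i)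
  exact ENNReal.ofReal_le_ofReal (pow_le_pow_left₀ hd.le (by linarith) 2)

end Moments

/-! ### From tail sum comparisons to attraction domains -/

section Attraction

variable {A : ℕ} {F : Fin A → ℝ → ℝ}

theorem measurableSet_unboundedEvent (j : Fin A) :
    MeasurableSet (unboundedEvent j : Set (ℕ → Fin A → ℕ)) := by
  have : (unboundedEvent j : Set (ℕ → Fin A → ℕ)) = ⋂ m : ℕ, ⋃ n : ℕ, {X | m ≤ X n j} := by
    ext X
    simp [unboundedEvent]
  rw [this]
  exact MeasurableSet.iInter fun m => MeasurableSet.iUnion fun n =>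
    measurableSet_le measurable_const ((measurable_pi_apply j).comp (measurable_pi_apply n))

/-- If every competitor stays bounded, agent `i` has a strong monopoly. The subadditive form avoids
measurability of `strongMonopoly i`. -/
theorem one_le_measure_strongMonopoly_add (hF : ∀ i x, 0 < x → 0 < F i x) {x₀ : Fin A → ℕ}
    {i : Fin A} (hi : x₀ i ≠ 0) :
    1 ≤ urnLaw F x₀ (strongMonopoly i) +
      ∑ j ∈ Finset.univ.erase i, urnLaw F x₀ (unboundedEvent j) := by
  have h1 : urnLaw F x₀ Set.univ ≤
      urnLaw F x₀ (strongMonopoly i ∪ ⋃ j ∈ Finset.univ.erase i, unboundedEvent j) := by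
    refine measure_mono_ae ?_
    filter_upwards [ae_isUrnPath hF hi] with X hX _
    by_contra hc
    have hc' : ¬ (X ∈ strongMonopoly i ∪ ⋃ j ∈ Finset.univ.erase i, unboundedEvent j) := hc
    simp only [Set.mem_union, Set.mem_iUnion, not_or, not_exists] at hc'
    exact hc'.1 (hX.mem_strongMonopoly fun j hj =>
      hc'.2 j (Finset.mem_erase.2 ⟨hj, Finset.mem_univ j⟩))
  rw [measure_univ] at h1
  exact h1.trans ((measure_union_le _ _).trans
    (add_le_add le_rfl (measure_biUnion_finset_le _ _)))

theorem measure_strongMonopoly_le (hF : ∀ i x, 0 < x → 0 < F i x) {x₀ : Fin A → ℕ} {i : Fin A}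
    (hi : x₀ i ≠ 0) : urnLaw F x₀ (strongMonopoly i) ≤ urnLaw F x₀ (unboundedEvent i) := by
  refine measure_mono_ae ?_
  filter_upwards [ae_isUrnPath hF hi] with X hX h
  exact hX.mem_unboundedEvent h

theorem measure_strongMonopoly_add_le_one (hF : ∀ i x, 0 < x → 0 < F i x) {x₀ : Fin A → ℕ}
    {i j : Fin A} (hij : i ≠ j) (hi : x₀ i ≠ 0) :
    urnLaw F x₀ (strongMonopoly i) + urnLaw F x₀ (strongMonopoly j) ≤ 1 := by
  have h1 : urnLaw F x₀ (strongMonopoly i) ≤ urnLaw F x₀ (unboundedEvent j)ᶜ := by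
    refine measure_mono_ae ?_
    filter_upwards [ae_isUrnPath hF hi] with X hX h
    exact strongMonopoly_notMem_unboundedEvent hij.symm h hX.monotone
  have h2 : urnLaw F x₀ (strongMonopoly j) ≤ urnLaw F x₀ (unboundedEvent j) := by
    refine measure_mono_ae ?_
    filter_upwards [ae_isUrnPath hF hi] with X hX h
    exact hX.mem_unboundedEvent h
  calc _ ≤ urnLaw F x₀ (unboundedEvent j)ᶜ + urnLaw F x₀ (unboundedEvent j) := add_le_add h1 h2
    _ = 1 := by
      rw [add_comm, measure_add_measure_compl (measurableSet_unboundedEvent j), measure_univ]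

theorem tendsto_initialState {χ : Fin A → ℝ} {i : Fin A} (hχ : 0 < χ i) :
    Tendsto (fun N : ℕ => initialState χ N i) atTop atTop :=
  tendsto_nat_floor_atTop.comp
    (tendsto_natCast_atTop_atTop.const_mul_atTop hχ)

theorem mem_attractionDomain_of_tendsto (hF : ∀ i x, 0 < x → 0 < F i x) {χ : Fin A → ℝ}
    (hχ : χ ∈ openSimplex A) {i : Fin A}
    (h : ∀ j, j ≠ i →
      Tendsto (fun N => urnLaw F (initialState χ N) (unboundedEvent j)) atTop (𝓝 0)) :
    χ ∈ attractionDomain F i := by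
  refine ⟨hχ, ?_⟩
  have hsum : Tendsto (fun N => 1 - ∑ j ∈ Finset.univ.erase i,
      urnLaw F (initialState χ N) (unboundedEvent j)) atTop (𝓝 1) := by
    have h1 := tendsto_finsetSum (Finset.univ.erase i)
      fun j hj => h j (Finset.ne_of_mem_erase hj)
    have h2 := ENNReal.Tendsto.sub (tendsto_const_nhds (x := (1 : ℝ≥0∞)) (f := atTop)) h1
      (Or.inl ENNReal.one_ne_top)
    simpa using h2
  refine tendsto_of_tendsto_of_tendsto_of_le_of_le' hsum tendsto_const_nhds ?_
    (Eventually.of_forall fun N => prob_le_one)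
  filter_upwards [(tendsto_initialState (hχ.2 i)).eventually_ne_atTop 0] with N hN
  rw [tsub_le_iff_right]
  exact one_le_measure_strongMonopoly_add hF hN

theorem notMem_attractionDomain_of_tendsto (hF : ∀ i x, 0 < x → 0 < F i x) {χ : Fin A → ℝ}
    {i : Fin A} (h : Tendsto (fun N => urnLaw F (initialState χ N) (unboundedEvent i)) atTop
      (𝓝 0)) : χ ∉ attractionDomain F i := by
  rintro ⟨hχ, h1⟩
  have h2 : Tendsto (fun N => urnLaw F (initialState χ N) (strongMonopoly i)) atTop (𝓝 0) := by
    refine tendsto_of_tendsto_of_tendsto_of_le_of_le' tendsto_const_nhds h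
      (Eventually.of_forall fun N => zero_le) ?_
    filter_upwards [(tendsto_initialState (hχ.2 i)).eventually_ne_atTop 0] with N hN
    exact measure_strongMonopoly_le hF hN
  exact one_ne_zero (tendsto_nhds_unique h1 h2)

theorem disjoint_attractionDomain (hF : ∀ i x, 0 < x → 0 < F i x) {i j : Fin A} (hij : i ≠ j) :
    Disjoint (attractionDomain F i) (attractionDomain F j) := by
  rw [Set.disjoint_left]
  rintro χ ⟨hχ, hi⟩ ⟨_, hj⟩
  have h2 : (1 + 1 : ℝ≥0∞) ≤ 1 := by
    refine le_of_tendsto (hi.add hj) ?_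
    filter_upwards [(tendsto_initialState (hχ.2 i)).eventually_ne_atTop 0] with N hN
    exact measure_strongMonopoly_add_le_one hF hij hN
  norm_num at h2

theorem tendsto_zero_of_forall_real {u : ℕ → ℝ≥0∞}
    (h : ∀ ε : ℝ, 0 < ε → ∀ᶠ N in atTop, u N ≤ ENNReal.ofReal ε) :
    Tendsto u atTop (𝓝 0) := by
  rw [ENNReal.tendsto_nhds_zero]
  intro ε hε
  obtain ⟨r, hr, hrε⟩ := ENNReal.lt_iff_exists_nnreal_btwn.1 hε
  filter_upwards [h r (by exact_mod_cast hr)] with N hN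
  exact hN.trans (by simpa using hrε.le)

theorem tendsto_unboundedEvent_of_mul (hF : ∀ i x, 0 < x → 0 < F i x) {χ : Fin A → ℝ}
    {i j : Fin A} (hi : 0 < χ i) (hj : 0 < χ j) (hM : MonopolyCondition (F i))
    (h : ∀ ε : ℝ, 0 < ε → ∀ᶠ N in atTop,
      F j (initialState χ N j) * tailSum (F i) (initialState χ N i) ≤ ε) :
    Tendsto (fun N => urnLaw F (initialState χ N) (unboundedEvent j)) atTop (𝓝 0) := by
  refine tendsto_zero_of_forall_real fun ε hε => ?_
  filter_upwards [(tendsto_initialState hi).eventually_ne_atTop 0,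
    (tendsto_initialState hj).eventually_ne_atTop 0, h ε hε] with N h1 h2 h3
  have hp : 0 < F j (initialState χ N j) := hF j _ (by positivity)
  -- With this `m` and the first clock step `1 / F j` as threshold, the bound is on the probability
  -- that `j` moves even once.
  have h4 := measure_exists_le_mul_le hF h1 h2 hM (m := initialState χ N j + 1)
    (one_div_pos.2 hp) (by simp)
  refine (measure_mono fun X hX => ?_).trans (h4.trans (ENNReal.ofReal_le_ofReal ?_))
  · exact hX _
  · rw [div_div_eq_mul_div, div_one, mul_comm]
    exact h3

theorem tendsto_unboundedEvent_of_not_monopolyCondition (hF : ∀ i x, 0 < x → 0 < F i x)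
    {χ : Fin A → ℝ} {i j : Fin A} (hi : 0 < χ i) (hj : 0 < χ j)
    (hM : MonopolyCondition (F i)) (hMj : ¬ MonopolyCondition (F j)) :
    Tendsto (fun N => urnLaw F (initialState χ N) (unboundedEvent j)) atTop (𝓝 0) := by
  refine tendsto_zero_of_forall_real fun ε hε => ?_
  filter_upwards [(tendsto_initialState hi).eventually_ne_atTop 0,
    (tendsto_initialState hj).eventually_ne_atTop 0] with N h1 h2
  have hS := tailSum_pos hM (hF i) (k := initialState χ N i) (by omega)
  -- The clock of `j` diverges, so the threshold in Markov's inequality can be chosen to give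
  -- exactly `ε`.
  obtain ⟨m, hm⟩ := exists_lt_sum_Ico_of_not_monopolyCondition hMj (hF j)
    (k := initialState χ N j) (by omega) (tailSum (F i) (initialState χ N i) / ε)
  have h4 := measure_exists_le_mul_le hF h1 h2 hM (div_pos hS hε) hm.le
  refine (measure_mono fun X hX => ?_).trans (h4.trans (ENNReal.ofReal_le_ofReal ?_))
  · exact hX _
  · rw [div_div_cancel₀ hS.ne']

/-- Type P makes each summand a small fraction of its tail sum: `1 / f l ≤ ε * tailSum f l ≤ ε *
tailSum f k`. Replace one factor of each square by this bound and sum the other. -/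
theorem IsTypeP.eventually_sum_sq_le {f : ℝ → ℝ} (h : IsTypeP f) (hf : ∀ x, 0 < x → 0 < f x)
    {ε : ℝ} (hε : 0 < ε) : ∀ᶠ k : ℕ in atTop, ∀ m,
      ∑ l ∈ Finset.Ico k m, (1 / f (l : ℝ)) ^ 2 ≤ ε * tailSum f k ^ 2 := by
  obtain ⟨K, hK⟩ := eventually_atTop.1 (h.2.eventually_ge_atTop (1 / ε))
  filter_upwards [eventually_ge_atTop (max K 1)] with k hk m
  have hk1 : 1 ≤ k := (le_max_right _ _).trans hk
  have hS := tailSum_pos h.1 hf hk1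
  have hb : ∀ l ∈ Finset.Ico k m,
      (1 / f (l : ℝ)) ^ 2 ≤ ε * tailSum f k * (1 / f (l : ℝ)) := by
    intro l hl
    have hkl := (Finset.mem_Ico.1 hl).1
    have hl0 : 0 < l := by omega
    have hp : 0 < f (l : ℝ) := hf _ (by positivity)
    have h1 := hK l ((le_max_left _ _).trans (hk.trans hkl))
    have h2 := tailSum_anti h.1 hf hk1 hkl
    have h3 : 1 / f (l : ℝ) ≤ ε * tailSum f k := by
      rw [div_le_iff₀ hp]
      rw [div_le_iff₀ hε] at h1
      nlinarith [mul_le_mul_of_nonneg_left h2 (mul_pos hε hp).le]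
    rw [sq]
    exact mul_le_mul_of_nonneg_right h3 (one_div_pos.2 hp).le
  calc _ ≤ ∑ l ∈ Finset.Ico k m, ε * tailSum f k * (1 / f (l : ℝ)) := Finset.sum_le_sum hb
    _ = ε * tailSum f k * ∑ l ∈ Finset.Ico k m, 1 / f (l : ℝ) := by rw [Finset.mul_sum]
    _ ≤ ε * tailSum f k * tailSum f k :=
      mul_le_mul_of_nonneg_left (sum_Ico_le_tailSum h.1 hf hk1 m) (by positivity)
    _ = _ := by ring

theorem tendsto_unboundedEvent_of_tailSum_le (hF : ∀ i x, 0 < x → 0 < F i x)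
    {χ : Fin A → ℝ} {i j : Fin A} (hij : i ≠ j) (hi : 0 < χ i) (hj : 0 < χ j)
    (hPi : IsTypeP (F i)) (hPj : IsTypeP (F j)) {δ : ℝ} (hδ : 0 < δ)
    (h : ∀ᶠ N in atTop, tailSum (F i) (initialState χ N i) ≤
      (1 - δ) * tailSum (F j) (initialState χ N j)) :
    Tendsto (fun N => urnLaw F (initialState χ N) (unboundedEvent j)) atTop (𝓝 0) := by
  refine tendsto_zero_of_forall_real fun ε hε => ?_
  -- With both sums of squares at most `η * t ^ 2` and gap `d = δ / 2 * t`, Chebyshev's bound is `2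
  -- * η * t ^ 2 / d ^ 2 = 8 * η / δ ^ 2 = ε`.
  have hη : 0 < ε * δ ^ 2 / 8 := by positivity
  filter_upwards [(tendsto_initialState hi).eventually_ne_atTop 0,
    (tendsto_initialState hj).eventually_ne_atTop 0, h,
    (tendsto_initialState hi).eventually (hPi.eventually_sum_sq_le (hF i) hη),
    (tendsto_initialState hj).eventually (hPj.eventually_sum_sq_le (hF j) hη)]
    with N h1 h2 h3 h4 h5
  have hSi := tailSum_pos hPi.1 (hF i) (k := initialState χ N i) (by omega)
  have hSj := tailSum_pos hPj.1 (hF j) (k := initialState χ N j) (by omega)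
  set s := tailSum (F i) (initialState χ N i)
  set t := tailSum (F j) (initialState χ N j)
  obtain ⟨m, hm⟩ := exists_lt_sum_Ico hPj.1 (initialState χ N j) (c := s + δ / 2 * t)
    (by change _ < t; nlinarith [mul_pos hδ hSj])
  have h6 := measure_exists_le_le_of_sq hF hij h1 h2 hPi.1 h4 h5 (d := δ / 2 * t)
    (by positivity) hm.le
  refine (measure_mono fun X hX => ?_).trans (h6.trans (ENNReal.ofReal_le_ofReal ?_))
  · exact hX _
  · have hst : s ≤ t := by nlinarith [mul_pos hδ hSj]
    rw [div_le_iff₀ (by positivity)]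
    have : s ^ 2 ≤ t ^ 2 := pow_le_pow_left₀ hSi.le hst 2
    nlinarith [mul_le_mul_of_nonneg_left this hη.le]

end Attraction

/-! ### Polytopes cut from the simplex by ratio constraints -/

section Geometry

variable {A : ℕ}

/-- The part of the unit simplex where `a j * χ j ≤ χ i` for `j ∈ J`. -/
def ratioPolytope (i : Fin A) (J : Finset (Fin A)) (a : Fin A → ℝ) : Set (Fin A → ℝ) :=
  {χ | χ ∈ stdSimplex ℝ (Fin A) ∧ ∀ j ∈ J, a j * χ j ≤ χ i}

/-- The part of the open simplex where `a j * χ j < χ i` for `j ∈ J`. -/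
def openRatioPolytope (i : Fin A) (J : Finset (Fin A)) (a : Fin A → ℝ) : Set (Fin A → ℝ) :=
  {χ | χ ∈ openSimplex A ∧ ∀ j ∈ J, a j * χ j < χ i}

theorem convex_ratioPolytope (i : Fin A) (J : Finset (Fin A)) (a : Fin A → ℝ) :
    Convex ℝ (ratioPolytope i J a) := by
  intro x hx y hy s t hs ht hst
  refine ⟨convex_stdSimplex ℝ _ hx.1 hy.1 hs ht hst, fun j hj => ?_⟩
  simp only [Pi.add_apply, Pi.smul_apply, smul_eq_mul]
  nlinarith [mul_le_mul_of_nonneg_left (hx.2 j hj) hs, mul_le_mul_of_nonneg_left (hy.2 j hj) ht]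

theorem isClosed_ratioPolytope (i : Fin A) (J : Finset (Fin A)) (a : Fin A → ℝ) :
    IsClosed (ratioPolytope i J a) := by
  have : ratioPolytope i J a =
      stdSimplex ℝ (Fin A) ∩ ⋂ j ∈ J, {χ | a j * χ j ≤ χ i} := by
    ext χ
    simp [ratioPolytope]
  rw [this]
  exact (isClosed_stdSimplex (𝕜 := ℝ) (ι := Fin A)).inter (isClosed_biInter fun j _ =>
    isClosed_le (by fun_prop) (by fun_prop))

theorem openRatioPolytope_subset (i : Fin A) (J : Finset (Fin A)) (a : Fin A → ℝ) :
    openRatioPolytope i J a ⊆ ratioPolytope i J a :=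
  fun _ h => ⟨h.1.1, fun j hj => (h.2 j hj).le⟩

theorem combo_mem_openRatioPolytope {i : Fin A} {J : Finset (Fin A)} {a : Fin A → ℝ}
    {x u : Fin A → ℝ} (hx : x ∈ ratioPolytope i J a) (hu : u ∈ openRatioPolytope i J a) {t : ℝ}
    (ht : 0 < t) (ht1 : t ≤ 1) : (1 - t) • x + t • u ∈ openRatioPolytope i J a := by
  have h1 : 0 ≤ 1 - t := by linarith
  refine ⟨⟨convex_stdSimplex ℝ _ hx.1 hu.1.1 h1 ht.le (by ring), fun k => ?_⟩, fun j hj => ?_⟩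
  · simp only [Pi.add_apply, Pi.smul_apply, smul_eq_mul]
    have := mul_nonneg h1 (hx.1.1 k)
    have := mul_pos ht (hu.1.2 k)
    linarith
  · simp only [Pi.add_apply, Pi.smul_apply, smul_eq_mul]
    nlinarith [mul_le_mul_of_nonneg_left (hx.2 j hj) h1,
      mul_lt_mul_of_pos_left (hu.2 j hj) ht]

theorem openRatioPolytope_nonempty (i : Fin A) {J : Finset (Fin A)} (hi : i ∉ J)
    (a : Fin A → ℝ) : (openRatioPolytope i J a).Nonempty := by
  set c : ℝ := 1 + ∑ j, |a j| with hc
  have hc0 : 0 < c := by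
    have : 0 ≤ ∑ j, |a j| := Finset.sum_nonneg fun j _ => abs_nonneg (a j)
    linarith
  set v : Fin A → ℝ := fun k => if k = i then c else 1 with hv
  have hvpos : ∀ k, 0 < v k := fun k => by
    simp only [hv]
    split_ifs
    · exact hc0
    · exact one_pos
  have hS : 0 < ∑ k, v k := Finset.sum_pos (fun k _ => hvpos k) ⟨i, Finset.mem_univ i⟩
  refine ⟨fun k => v k / ∑ k, v k, ⟨⟨fun k => (div_pos (hvpos k) hS).le, ?_⟩,
    fun k => div_pos (hvpos k) hS⟩, fun j hj => ?_⟩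
  · rw [← Finset.sum_div, div_self hS.ne']
  · have hji : j ≠ i := fun h => hi (h ▸ hj)
    rw [← mul_div_assoc]
    refine div_lt_div_of_pos_right ?_ hS
    simp only [hv, if_neg hji, if_true, mul_one]
    have : |a j| ≤ ∑ j, |a j| :=
      Finset.single_le_sum (f := fun j => |a j|) (fun _ _ => abs_nonneg _) (Finset.mem_univ j)
    have := le_abs_self (a j)
    linarith

theorem closure_openRatioPolytope (i : Fin A) {J : Finset (Fin A)} (hi : i ∉ J)
    (a : Fin A → ℝ) : closure (openRatioPolytope i J a) = ratioPolytope i J a := by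
  refine subset_antisymm (closure_minimal (openRatioPolytope_subset i J a)
    (isClosed_ratioPolytope i J a)) fun x hx => ?_
  obtain ⟨u, hu⟩ := openRatioPolytope_nonempty i hi a
  have hc : Tendsto (fun t : ℝ => (1 - t) • x + t • u) (𝓝[>] 0) (𝓝 x) := by
    have : ContinuousAt (fun t : ℝ => (1 - t) • x + t • u) 0 := by fun_prop
    have h2 := this.tendsto
    simp only [sub_zero, one_smul, zero_smul, add_zero] at h2
    exact h2.mono_left nhdsWithin_le_nhds
  refine mem_closure_of_tendsto hc ?_
  filter_upwards [Ioc_mem_nhdsGT (zero_lt_one (α := ℝ))] with t ht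
  exact combo_mem_openRatioPolytope hx hu ht.1 ht.2

/-- Choose `u` in the strict set. From a relative interior point one can move a little away from `u`
and stay in the polytope; the point is then a convex combination of the new point and `u` with
positive weight on `u`, so all inequalities are strict. -/
theorem intrinsicInterior_ratioPolytope_subset (i : Fin A) {J : Finset (Fin A)} (hi : i ∉ J)
    (a : Fin A → ℝ) :
    intrinsicInterior ℝ (ratioPolytope i J a) ⊆ openRatioPolytope i J a := by
  intro x hx
  obtain ⟨u, hu⟩ := openRatioPolytope_nonempty i hi a
  obtain ⟨y, hy, rfl⟩ := hx
  have hxP : (y : Fin A → ℝ) ∈ ratioPolytope i J a := by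
    have h : y ∈ ((↑) ⁻¹' ratioPolytope i J a : Set (affineSpan ℝ (ratioPolytope i J a))) :=
      interior_subset hy
    exact h
  have huS : u ∈ affineSpan ℝ (ratioPolytope i J a) :=
    subset_affineSpan ℝ _ (openRatioPolytope_subset i J a hu)
  set g : ℝ → affineSpan ℝ (ratioPolytope i J a) := fun t =>
    ⟨AffineMap.lineMap (y : Fin A → ℝ) u t, AffineMap.lineMap_mem t y.2 huS⟩ with hg
  have hgc : Continuous g := Continuous.subtype_mk (AffineMap.lineMap_continuous) _
  have hg0 : g 0 = y := by
    ext1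
    simp [hg]
  have hmem : ∀ᶠ t in 𝓝 (0 : ℝ), g t ∈
      ((↑) ⁻¹' ratioPolytope i J a : Set (affineSpan ℝ (ratioPolytope i J a))) := by
    refine hgc.continuousAt.eventually ?_
    rw [hg0]
    exact mem_interior_iff_mem_nhds.1 hy
  obtain ⟨ε, hε, hb⟩ := Metric.eventually_nhds_iff.1 hmem
  have hz := hb (y := -(ε / 2)) (by
    rw [dist_zero_right, norm_neg, Real.norm_eq_abs, abs_of_pos (by positivity)]
    linarith)
  have hz' : AffineMap.lineMap (y : Fin A → ℝ) u (-(ε / 2)) ∈ ratioPolytope i J a := hz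
  have key := combo_mem_openRatioPolytope hz' hu (t := (ε / 2) / (1 + ε / 2)) (by positivity)
    (by rw [div_le_one (by positivity)]; linarith)
  convert key using 1
  ext k
  simp only [AffineMap.lineMap_apply, vsub_eq_sub, vadd_eq_add, Pi.add_apply, Pi.smul_apply,
    Pi.sub_apply, smul_eq_mul]
  field_simp
  ring

/-- Scaling to coordinate sum `1` turns a convex combination into one of the scaled points with new
weights, so it carries convex hulls into convex sets. -/
theorem smul_mem_convexHull_normalize {T C : Set (Fin A → ℝ)} (hC : Convex ℝ C)
    (hT : ∀ v ∈ T, 0 < ∑ k, v k ∧ (∑ k, v k)⁻¹ • v ∈ C) {v : Fin A → ℝ}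
    (hv : v ∈ convexHull ℝ T) : 0 < ∑ k, v k ∧ (∑ k, v k)⁻¹ • v ∈ C := by
  refine convexHull_min (t := {v : Fin A → ℝ | 0 < ∑ k, v k ∧ (∑ k, v k)⁻¹ • v ∈ C})
    (fun v hv => hT v hv) ?_ hv
  intro x hx y hy s t hs ht hst
  have hsum : ∑ k, (s • x + t • y) k = s * ∑ k, x k + t * ∑ k, y k := by
    simp [Finset.sum_add_distrib, Finset.mul_sum]
  have hp : 0 < s * ∑ k, x k + t * ∑ k, y k := by
    rcases hs.eq_or_lt with rfl | hs'
    · have : t = 1 := by linarith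
      subst this
      simpa using hy.1
    · have := mul_pos hs' hx.1
      have := mul_nonneg ht hy.1.le
      linarith
  have hx1 := hx.1
  have hy1 := hy.1
  refine ⟨by rw [hsum]; exact hp, ?_⟩
  rw [hsum]
  have h1 := hC hx.2 hy.2
    (div_nonneg (mul_nonneg hs hx.1.le) hp.le) (div_nonneg (mul_nonneg ht hy.1.le) hp.le)
    (by rw [← add_div, div_self hp.ne'])
  convert h1 using 1
  ext k
  simp only [Pi.add_apply, Pi.smul_apply, smul_eq_mul]
  field_simp

/-- In the slice `χ i = 1` of the cone over the polytope, coordinate `j` ranges over `[0, 1 / a j]`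
when effectively constrained and over `[0, ∞)` otherwise. The box of constrained coordinates is the
hull of its corners, which are scaled back to the simplex; each free coordinate adds a unit vector.
-/
theorem isPolytope_ratioPolytope (i : Fin A) {J : Finset (Fin A)} (hi : i ∉ J)
    {a : Fin A → ℝ} (ha : ∀ j, 0 ≤ a j) : IsPolytope (ratioPolytope i J a) := by
  classical
  set t : Fin A → Set ℝ := fun j =>
    if j = i then {1} else if j ∈ J ∧ 0 < a j then {0, (a j)⁻¹} else {0} with ht
  have htfin : ∀ j, (t j).Finite := fun j => by
    simp only [ht]
    split_ifs <;> simp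
  set T : Set (Fin A → ℝ) := Set.pi Set.univ t with hT
  have hTfin : T.Finite := Set.Finite.pi' htfin |>.subset fun v hv j => hv j (Set.mem_univ j)
  set V₁ : Set (Fin A → ℝ) := (fun v => (∑ k, v k)⁻¹ • v) '' T
  set V₂ : Set (Fin A → ℝ) :=
    (fun j => Pi.single j (1 : ℝ)) '' {j | j ≠ i ∧ ¬ (j ∈ J ∧ 0 < a j)} with hV₂
  have hfin : (V₁ ∪ V₂).Finite := (hTfin.image _).union (Set.toFinite _)
  refine ⟨hfin.toFinset, ?_⟩
  rw [Set.Finite.coe_toFinset]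
  have hTi : ∀ v ∈ T, v i = 1 := fun v hv => by
    have := hv i (Set.mem_univ i)
    simpa [ht] using this
  have hTj : ∀ v ∈ T, ∀ j, j ≠ i → 0 ≤ v j ∧ a j * v j ≤ 1 := fun v hv j hj => by
    have h1 := hv j (Set.mem_univ j)
    simp only [ht, if_neg hj] at h1
    split_ifs at h1 with h2
    · rcases h1 with h1 | h1
      · simp [h1]
      · rw [Set.mem_singleton_iff.1 h1]
        exact ⟨inv_nonneg.2 h2.2.le, (mul_inv_cancel₀ h2.2.ne').le⟩
    · rw [Set.mem_singleton_iff.1 h1]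
      simp
  have hTnn : ∀ v ∈ T, ∀ k, 0 ≤ v k := fun v hv k => by
    by_cases hk : k = i
    · rw [hk, hTi v hv]
      exact zero_le_one
    · exact (hTj v hv k hk).1
  have hTsum : ∀ v ∈ T, 0 < ∑ k, v k := fun v hv => by
    refine Finset.sum_pos' (fun k _ => hTnn v hv k) ⟨i, Finset.mem_univ i, ?_⟩
    rw [hTi v hv]
    exact one_pos
  have hTne : (Pi.single i 1 : Fin A → ℝ) ∈ T := by
    intro j _
    simp only [ht]
    split_ifs with h1 h2
    · simp [h1]
    · simp [Pi.single_eq_of_ne h1]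
    · simp [Pi.single_eq_of_ne h1]
  refine subset_antisymm ?_ (convexHull_min ?_ (convex_ratioPolytope i J a))
  · intro χ hχ
    have hconv := convex_convexHull ℝ (V₁ ∪ V₂)
    set free : Fin A → Prop := fun j => j ≠ i ∧ ¬ (j ∈ J ∧ 0 < a j) with hfree
    set y : Fin A → ℝ := fun j => if free j then 0 else χ j with hy
    have hynn : ∀ j, 0 ≤ y j := fun j => by
      simp only [hy]
      split_ifs
      · exact le_rfl
      · exact hχ.1.1 j
    have hyi : y i = χ i := by simp [hy, hfree]
    have hw : ∃ w ∈ convexHull ℝ (V₁ ∪ V₂), (∑ k, y k) • w = y := by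
      -- If `χ i = 0`, the constraints kill every coordinate of `y`, and any point of the hull
      -- serves as `w` with coefficient `0`.
      rcases (hχ.1.1 i).eq_or_lt with h0 | h0
      · have hy0 : y = 0 := by
          ext j
          by_cases hfj : free j
          · simp [hy, hfj]
          · by_cases hji : j = i
            · rw [hji, hyi, ← h0]
              rfl
            · have hj2 : j ∈ J ∧ 0 < a j := by
                by_contra hc
                exact hfj ⟨hji, hc⟩
              have h2 := hχ.2 j hj2.1
              simp only [hy, if_neg hfj, Pi.zero_apply]
              have h3 := hχ.1.1 j
              rw [← h0] at h2
              nlinarith [mul_nonneg hj2.2.le h3]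
        exact ⟨_, subset_convexHull ℝ _ (Or.inl ⟨_, hTne, rfl⟩), by simp [hy0]⟩
      · have hmem : (χ i)⁻¹ • y ∈ convexHull ℝ T := by
          rw [hT, convexHull_pi]
          intro j _
          simp only [Pi.smul_apply, smul_eq_mul, ht]
          split_ifs with h1 h2
          · rw [h1, hyi, inv_mul_cancel₀ h0.ne']
            simp
          · rw [convexHull_pair, segment_eq_Icc (inv_nonneg.2 h2.2.le)]
            refine ⟨mul_nonneg (inv_nonneg.2 h0.le) (hynn j), ?_⟩
            have hnf : ¬ free j := fun h => h.2 h2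
            have h3 := hχ.2 j h2.1
            have h4 := h2.2
            simp only [hy, if_neg hnf]
            rw [inv_mul_le_iff₀ h0, ← div_eq_mul_inv, le_div_iff₀ h4]
            linarith
          · have : free j := ⟨h1, h2⟩
            simp [hy, this]
        obtain ⟨h1, h2⟩ := smul_mem_convexHull_normalize hconv (fun v hv =>
          ⟨hTsum v hv, subset_convexHull ℝ _ (Or.inl ⟨v, hv, rfl⟩)⟩) hmem
        refine ⟨_, h2, ?_⟩
        have hsum : ∑ k, ((χ i)⁻¹ • y) k = (χ i)⁻¹ * ∑ k, y k := by
          simp [Finset.mul_sum]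
        rw [hsum] at h1 ⊢
        have h3 : 0 < ∑ k, y k := by
          by_contra hc
          have := mul_nonpos_of_nonneg_of_nonpos (inv_nonneg.2 h0.le) (not_lt.1 hc)
          linarith
        ext k
        simp only [Pi.smul_apply, smul_eq_mul]
        field_simp
    obtain ⟨w, hwC, hwy⟩ := hw
    -- The free coordinates are weights on unit vectors; the total mass of `y` is the weight of `w`,
    -- stored at the index `i`, which is never free.
    have hyz : χ = ∑ j, (if free j then χ j else if j = i then ∑ k, y k else 0) •
        (if free j then Pi.single j (1 : ℝ) else w) := by
      have : ∀ j, (if free j then χ j else if j = i then ∑ k, y k else 0) •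
          (if free j then Pi.single j (1 : ℝ) else w) =
          (if free j then Pi.single j (χ j) else 0) + (if j = i then y else 0) := by
        intro j
        by_cases hj : free j
        · have hji : j ≠ i := hj.1
          simp only [if_pos hj, if_neg hji, add_zero]
          rw [← Pi.single_smul, smul_eq_mul, mul_one]
        · by_cases hji : j = i
          · simp only [if_neg hj, if_pos hji, zero_add, hwy]
          · simp only [if_neg hj, if_neg hji, zero_smul, add_zero]
      rw [Finset.sum_congr rfl fun j _ => this j, Finset.sum_add_distrib,
        Finset.sum_ite_eq' Finset.univ i, if_pos (Finset.mem_univ i)]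
      ext k
      simp only [Pi.add_apply, Finset.sum_apply]
      rw [Finset.sum_eq_single k]
      · by_cases hk : free k
        · simp [hy, hk]
        · simp [hy, hk]
      · intro b _ hb
        split_ifs
        · rw [Pi.single_eq_of_ne hb.symm]
        · rfl
      · simp
    rw [hyz]
    refine hconv.sum_mem (fun j _ => ?_) ?_ fun j _ => ?_
    · split_ifs
      · exact hχ.1.1 j
      · exact Finset.sum_nonneg fun k _ => hynn k
      · exact le_rfl
    · have h1 : ∀ j, (if free j then χ j else if j = i then ∑ k, y k else 0) =
          (χ j - y j) + if j = i then ∑ k, y k else 0 := by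
        intro j
        by_cases hj : free j
        · have hji : j ≠ i := hj.1
          simp [hj, hji, hy]
        · simp [hj, hy]
      rw [Finset.sum_congr rfl fun j _ => h1 j, Finset.sum_add_distrib,
        Finset.sum_ite_eq' Finset.univ i, if_pos (Finset.mem_univ i), Finset.sum_sub_distrib,
        hχ.1.2]
      ring
    · split_ifs with hj
      · exact subset_convexHull ℝ _ (Or.inr ⟨j, hj, rfl⟩)
      · exact hwC
  · rintro _ (⟨v, hv, rfl⟩ | ⟨j, hj, rfl⟩)
    · have hs := hTsum v hv
      refine ⟨⟨fun k => mul_nonneg (inv_nonneg.2 hs.le) (hTnn v hv k), ?_⟩, fun j hj => ?_⟩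
      · simp only [Pi.smul_apply, smul_eq_mul]
        rw [← Finset.mul_sum, inv_mul_cancel₀ hs.ne']
      · have hji : j ≠ i := fun h => hi (h ▸ hj)
        simp only [Pi.smul_apply, smul_eq_mul, hTi v hv]
        nlinarith [mul_le_mul_of_nonneg_left (hTj v hv j hji).2 (inv_nonneg.2 hs.le)]
    · refine ⟨single_mem_stdSimplex ℝ j, fun k hk => ?_⟩
      have hji : i ≠ j := hj.1.symm
      change a k * (Pi.single j (1 : ℝ) : Fin A → ℝ) k ≤ (Pi.single j (1 : ℝ) : Fin A → ℝ) i
      rw [Pi.single_eq_of_ne hji]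
      by_cases hkj : k = j
      · subst hkj
        have h0 : a k = 0 := by
          by_contra hc
          exact hj.2 ⟨hk, lt_of_le_of_ne (ha k) (Ne.symm hc)⟩
        simp [h0]
      · simp [Pi.single_eq_of_ne hkj]

end Geometry

/-! ### Dissection by pairwise comparisons -/

section Dissection

variable {A : ℕ}

theorem finite_setOf_mul_exp_eq {c d p q : ℝ} (hc : 0 < c) (hpq : p ≠ q) :
    {t : ℝ | c * Real.exp (t * p) = d * Real.exp (t * q)}.Finite := by
  refine Set.Subsingleton.finite fun s hs t ht => ?_
  have key : ∀ t : ℝ, c * Real.exp (t * p) = d * Real.exp (t * q) →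
      Real.exp (t * (p - q)) = d / c := fun t h => by
    rw [mul_sub, Real.exp_sub, div_eq_div_iff (Real.exp_pos _).ne' hc.ne']
    linarith
  have h1 := Real.exp_injective ((key s hs).trans (key t ht).symm)
  exact mul_right_cancel₀ (sub_ne_zero.2 hpq) h1

/-- In each neighbourhood of a point of the open simplex there is a point of the open simplex that
avoids the finitely many hyperplanes `χ i = a i j * χ j`. -/
theorem mem_closure_generic (a : Fin A → Fin A → ℝ) {χ : Fin A → ℝ} (hχ : χ ∈ openSimplex A) :
    χ ∈ closure {ψ | ψ ∈ openSimplex A ∧ ∀ i j, i ≠ j → ψ i ≠ a i j * ψ j} := by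
  -- Tilt the shares by `exp (t * k)`. The exponents are distinct, so each forbidden hyperplane is
  -- met for at most one `t`.
  set γ : ℝ → Fin A → ℝ := fun t k =>
    χ k * Real.exp (t * k) / ∑ l, χ l * Real.exp (t * (l : ℕ)) with hγ
  set bad : Set ℝ := ⋃ i : Fin A, ⋃ j : Fin A, {t : ℝ | i ≠ j ∧
    χ i * Real.exp (t * (i : ℕ)) = a i j * χ j * Real.exp (t * (j : ℕ))} with hbad
  have hfin : bad.Finite := by
    refine Set.finite_iUnion fun i => Set.finite_iUnion fun j => ?_
    by_cases hij : i = j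
    · simp [hij]
    · refine (finite_setOf_mul_exp_eq (d := a i j * χ j) (hχ.2 i)
        (p := (i : ℕ)) (q := (j : ℕ)) ?_).subset fun t ht => ht.2
      exact_mod_cast fun h => hij (Fin.ext h)
  have hne : ∃ i : Fin A, True := by
    by_contra hc
    have h1 := hχ.1.2
    rw [Finset.sum_eq_zero fun i _ => absurd ⟨i, trivial⟩ hc] at h1
    exact zero_ne_one h1
  obtain ⟨i₀, -⟩ := hne
  have hS : ∀ t : ℝ, 0 < ∑ l, χ l * Real.exp (t * (l : ℕ)) := fun t =>
    Finset.sum_pos (fun l _ => mul_pos (hχ.2 l) (Real.exp_pos _)) ⟨i₀, Finset.mem_univ _⟩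
  have hcont : Continuous γ := by
    refine continuous_pi fun k => ?_
    simp only [hγ]
    exact Continuous.div (by fun_prop) (by fun_prop) fun t => (hS t).ne'
  have h0 : γ 0 = χ := by
    ext k
    simp [hγ, hχ.1.2]
  have hd : (0 : ℝ) ∈ closure badᶜ := hfin.countable.dense_compl ℝ 0
  rw [← h0]
  refine closure_mono ?_ (image_closure_subset_closure_image hcont ⟨0, hd, rfl⟩)
  rintro _ ⟨t, ht, rfl⟩
  have hpos : ∀ k, 0 < γ t k := fun k =>
    div_pos (mul_pos (hχ.2 k) (Real.exp_pos _)) (hS t)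
  refine ⟨⟨⟨fun k => (hpos k).le, ?_⟩, hpos⟩, fun i j hij h => ht ?_⟩
  · simp only [hγ]
    rw [← Finset.sum_div, div_self (hS t).ne']
  · simp only [hbad, Set.mem_iUnion]
    refine ⟨i, j, hij, ?_⟩
    simp only [hγ] at h
    rw [← mul_div_assoc, div_left_inj' (hS t).ne'] at h
    rw [h, mul_assoc]

/-- A dissection of the simplex by pairwise comparisons. The relation `B i j ρ` says that agent
`i` beats agent `j` when the ratio of their market shares exceeds `ρ`. -/
theorem dissection (W : Finset (Fin A)) (hW : W.Nonempty) (B : Fin A → Fin A → ℝ → Prop)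
    (D : Fin A → Set (Fin A → ℝ)) (hD : ∀ i, D i ⊆ openSimplex A) (hDW : ∀ i ∉ W, D i = ∅)
    (hdense : ∀ i ∈ W, ∀ j ∈ W, i ≠ j → ∀ r₀ r₁ : ℝ, 0 < r₀ → r₀ < r₁ →
      ∃ ρ, r₀ < ρ ∧ ρ < r₁ ∧ (B i j ρ ∨ B j i ρ⁻¹))
    (hscore : ∀ χ ∈ openSimplex A, ∃ s : Fin A → ℕ → ℝ, ∀ i ∈ W, ∀ j ∈ W, i ≠ j → ∀ ρ,
      0 < ρ → ρ * χ j < χ i → B i j ρ → ∀ᶠ N in atTop, s i N < s j N)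
    (hwin : ∀ χ ∈ openSimplex A, ∀ i ∈ W,
      (∀ j ∈ W, j ≠ i → ∃ ρ, 0 < ρ ∧ ρ * χ j < χ i ∧ B i j ρ) → χ ∈ D i)
    (hlose : ∀ χ ∈ openSimplex A, ∀ i ∈ W, ∀ j ∈ W, j ≠ i → ∀ ρ, 0 < ρ → ρ * χ i < χ j →
      B j i ρ → χ ∉ D i) :
    (∀ i, IsPolytope (closure (D i)) ∧ intrinsicInterior ℝ (closure (D i)) ⊆ D i) ∧
      (⋃ i, closure (D i)) = stdSimplex ℝ (Fin A) := by
  classical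
  set T : Fin A → Fin A → Set ℝ := fun i j => {ρ | 0 < ρ ∧ B i j ρ} with hT
  -- `a i j` is the share ratio above which `i` beats `j`. The infimum of an empty set is `0`, so
  -- nonemptiness of `T i j` has to be carried along separately.
  set a : Fin A → Fin A → ℝ := fun i j => sInf (T i j) with ha
  have hbdd : ∀ i j, BddBelow (T i j) := fun i j => ⟨0, fun ρ hρ => hρ.1.le⟩
  have ha0 : ∀ i j, 0 ≤ a i j := fun i j => Real.sInf_nonneg fun ρ hρ => hρ.1.le
  have hwins : ∀ χ ∈ openSimplex A, ∀ i j, (T i j).Nonempty → a i j * χ j < χ i →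
      ∃ ρ, 0 < ρ ∧ ρ * χ j < χ i ∧ B i j ρ := by
    intro χ hχ i j hne h
    rw [← lt_div_iff₀ (hχ.2 j)] at h
    obtain ⟨ρ, hρ, hlt⟩ := exists_lt_of_csInf_lt hne h
    exact ⟨ρ, hρ.1, (lt_div_iff₀ (hχ.2 j)).1 hlt, hρ.2⟩
  have hloses : ∀ χ ∈ openSimplex A, ∀ i ∈ W, ∀ j ∈ W, i ≠ j →
      ((T i j).Nonempty ∧ a i j * χ j ≤ χ i) ∨ ∃ ρ, 0 < ρ ∧ ρ * χ i < χ j ∧ B j i ρ := by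
    intro χ hχ i hi j hj hij
    by_contra hc
    rw [not_or] at hc
    have hr : 0 < χ i / χ j := div_pos (hχ.2 i) (hχ.2 j)
    have h1 : ∃ r₁, χ i / χ j < r₁ ∧ ∀ ρ < r₁, 0 < ρ → ¬ B i j ρ := by
      rcases Set.eq_empty_or_nonempty (T i j) with he | hne
      · refine ⟨χ i / χ j + 1, by linarith, fun ρ _ h0 hB => ?_⟩
        have : ρ ∈ T i j := ⟨h0, hB⟩
        rw [he] at this
        exact this
      · refine ⟨a i j, ?_, fun ρ hρ h0 hB => ?_⟩
        · rw [div_lt_iff₀ (hχ.2 j)]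
          exact not_le.1 fun h => hc.1 ⟨hne, h⟩
        · exact absurd (csInf_le (hbdd i j) (show ρ ∈ T i j from ⟨h0, hB⟩)) (not_le.2 hρ)
    obtain ⟨r₁, hr₁, hno⟩ := h1
    -- If `χ i / χ j` is below the threshold, or there is none, a comparison just above this ratio
    -- must favour `j`.
    obtain ⟨ρ, hρ0, hρ1, hB⟩ := hdense i hi j hj hij _ _ hr hr₁
    have hρ : 0 < ρ := hr.trans hρ0
    rcases hB with hB | hB
    · exact hno ρ hρ1 hρ hB
    · refine hc.2 ⟨ρ⁻¹, inv_pos.2 hρ, ?_, hB⟩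
      rw [div_lt_iff₀ (hχ.2 j)] at hρ0
      rwa [inv_mul_lt_iff₀ hρ]
  have hmain : ∀ i, D i = ∅ ∨ ∃ J : Finset (Fin A), i ∉ J ∧
      openRatioPolytope i J (a i) ⊆ D i ∧ D i ⊆ ratioPolytope i J (a i) := by
    intro i
    rcases Set.eq_empty_or_nonempty (D i) with he | ⟨χ₀, hχ₀⟩
    · exact Or.inl he
    · have hi : i ∈ W := by
        by_contra hi
        rw [hDW i hi] at hχ₀
        exact hχ₀
      -- A single point of `D i` suffices for all sets `T i j` to be nonempty: there no contender
      -- beats `i`.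
      have hsub : ∀ χ ∈ D i, ∀ j ∈ W, j ≠ i → (T i j).Nonempty ∧ a i j * χ j ≤ χ i := by
        intro χ hχ j hj hji
        refine (hloses χ (hD i hχ) i hi j hj hji.symm).resolve_right ?_
        rintro ⟨ρ, hρ, hlt, hB⟩
        exact hlose χ (hD i hχ) i hi j hj hji ρ hρ hlt hB hχ
      refine Or.inr ⟨W.erase i, Finset.notMem_erase i W, fun χ hχ => ?_, fun χ hχ => ?_⟩
      · refine hwin χ hχ.1 i hi fun j hj hji => ?_
        exact hwins χ hχ.1 i j (hsub χ₀ hχ₀ j hj hji).1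
          (hχ.2 j (Finset.mem_erase.2 ⟨hji, hj⟩))
      · exact ⟨(hD i hχ).1, fun j hj => (hsub χ hχ j (Finset.mem_of_mem_erase hj)
          (Finset.ne_of_mem_erase hj)).2⟩
  refine ⟨fun i => ?_, ?_⟩
  · rcases hmain i with he | ⟨J, hiJ, hU, hP⟩
    · rw [he, closure_empty, intrinsicInterior_empty]
      exact ⟨⟨∅, by simp⟩, subset_rfl⟩
    · have hcl : closure (D i) = ratioPolytope i J (a i) :=
        subset_antisymm (closure_minimal hP (isClosed_ratioPolytope i J (a i)))
          ((closure_openRatioPolytope i hiJ (a i)).symm.subset.trans (closure_mono hU))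
      rw [hcl]
      exact ⟨isPolytope_ratioPolytope i hiJ (ha0 i),
        (intrinsicInterior_ratioPolytope_subset i hiJ (a i)).trans hU⟩
  · refine subset_antisymm (Set.iUnion_subset fun i => closure_minimal
      (fun χ hχ => (hD i hχ).1) (isClosed_stdSimplex (𝕜 := ℝ) (ι := Fin A))) ?_
    rw [← closure_iUnion_of_finite]
    have hgen : {ψ | ψ ∈ openSimplex A ∧ ∀ i j, i ≠ j → ψ i ≠ a i j * ψ j} ⊆ ⋃ i, D i := by
      rintro χ ⟨hχ, hne⟩
      set Win : Fin A → Fin A → Prop := fun i j => ∃ ρ, 0 < ρ ∧ ρ * χ j < χ i ∧ B i j ρ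
      have htot : ∀ i ∈ W, ∀ j ∈ W, i ≠ j → Win i j ∨ Win j i := by
        intro i hi j hj hij
        rcases hloses χ hχ i hi j hj hij with ⟨h1, h2⟩ | h
        · exact Or.inl (hwins χ hχ i j h1 (lt_of_le_of_ne h2 (hne i j hij).symm))
        · exact Or.inr h
      obtain ⟨s, hs⟩ := hscore χ hχ
      have hev : ∀ᶠ N in atTop, ∀ i j, i ∈ W → j ∈ W → i ≠ j → Win i j → s i N < s j N := by
        rw [eventually_all]
        intro i
        rw [eventually_all]
        intro j
        by_cases h : i ∈ W ∧ j ∈ W ∧ i ≠ j ∧ Win i j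
        · obtain ⟨hi, hj, hij, ρ, hρ, hlt, hB⟩ := h
          filter_upwards [hs i hi j hj hij ρ hρ hlt hB] with N hN _ _ _ _
          exact hN
        · exact Eventually.of_forall fun N h1 h2 h3 h4 => absurd ⟨h1, h2, h3, h4⟩ h
      -- At one `N` all pairwise victories are reflected in the scores. The agent of least score
      -- loses to nobody and, as every pair is decided at a generic point, beats all others.
      obtain ⟨N, hN⟩ := hev.exists
      obtain ⟨i, hi, hmin⟩ := W.exists_min_image (fun i => s i N) hW
      refine Set.mem_iUnion.2 ⟨i, hwin χ hχ i hi fun j hj hji => ?_⟩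
      refine (htot i hi j hj hji.symm).resolve_right fun h => ?_
      exact absurd (hN j i hj hi hji h) (not_lt.2 (hmin j hj))
    refine fun χ hχ => closure_minimal (s := openSimplex A) ?_ isClosed_closure ?_
    · exact fun ψ hψ => closure_mono hgen (mem_closure_generic a hψ)
    · obtain ⟨i, hi⟩ := hW
      have h1 := (closure_openRatioPolytope i (J := ∅) (Finset.notMem_empty i) 0).symm.subset
        (show χ ∈ _ from ⟨hχ, by simp⟩)
      exact closure_mono (fun ψ hψ => hψ.1) h1

end Dissection

/-! ### From rays to sectors by Baire category -/

section Sectors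

/-- A pointwise dichotomy between two bounds for `f` in terms of `g` along rays is uniform on some
subsector of each sector. -/
theorem exists_sector_of_dichotomy {f g : ℝ → ℝ} (hf : ContinuousOn f (Set.Ioi 0))
    (hg : ContinuousOn g (Set.Ioi 0)) (α β : ℕ → ℝ)
    (h : ∀ t : ℝ, 0 < t → t < 1 → ∃ K : ℕ,
      (∀ n : ℕ, K < n → f (t * n) ≤ β K * g ((1 - t) * n)) ∨
      (∀ n : ℕ, K < n → α K * g ((1 - t) * n) ≤ f (t * n)))
    {r₀ r₁ : ℝ} (hr₀ : 0 < r₀) (hr : r₀ < r₁) :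
    ∃ (s₀ s₁ : ℝ) (K : ℕ), r₀ < s₀ ∧ s₀ < s₁ ∧ s₁ < r₁ ∧
      ((∀ x y : ℕ, 1 ≤ y → K < x → s₀ * y ≤ x → x ≤ s₁ * y → f x ≤ β K * g y) ∨
      (∀ x y : ℕ, 1 ≤ y → K < x → s₀ * y ≤ x → x ≤ s₁ * y → α K * g y ≤ f x)) := by
  -- The parameter `s` is the logarithm of the slope `t / (1 - t)`, so that the rays are indexed by
  -- the complete space `ℝ`. The closed sets `E p` below form a countable cover, and Baire's theorem
  -- makes the union of their interiors dense.
  set t : ℝ → ℝ := fun s => Real.exp s / (1 + Real.exp s) with ht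
  have hpos : ∀ s, 0 < 1 + Real.exp s := fun s => by positivity
  have ht0 : ∀ s, 0 < t s := fun s => div_pos (Real.exp_pos s) (hpos s)
  have ht1 : ∀ s, t s < 1 := fun s => by
    simp only [ht]
    rw [div_lt_one (hpos s)]
    linarith
  have htc : Continuous t := Continuous.div (by fun_prop) (by fun_prop) fun s => (hpos s).ne'
  have hfc : ∀ n : ℕ, 0 < n → Continuous fun s => f (t s * n) := fun n hn =>
    hf.comp_continuous (by fun_prop) fun s => mul_pos (ht0 s) (by exact_mod_cast hn)
  have hgc : ∀ n : ℕ, 0 < n → Continuous fun s => g ((1 - t s) * n) := fun n hn =>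
    hg.comp_continuous (by fun_prop) fun s =>
      mul_pos (sub_pos.2 (ht1 s)) (by exact_mod_cast hn)
  set E : Bool × ℕ → Set ℝ := fun p => if p.1
    then ⋂ n : ℕ, ⋂ _ : p.2 < n, {s | f (t s * n) ≤ β p.2 * g ((1 - t s) * n)}
    else ⋂ n : ℕ, ⋂ _ : p.2 < n, {s | α p.2 * g ((1 - t s) * n) ≤ f (t s * n)} with hE
  have hclosed : ∀ p, IsClosed (E p) := by
    rintro ⟨b, K⟩
    cases b
    · exact isClosed_iInter fun n => isClosed_iInter fun hn => isClosed_le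
        ((hgc n (by omega)).const_mul _) (hfc n (by omega))
    · exact isClosed_iInter fun n => isClosed_iInter fun hn => isClosed_le
        (hfc n (by omega)) ((hgc n (by omega)).const_mul _)
  have hcover : ⋃ p, E p = Set.univ := by
    refine Set.eq_univ_of_forall fun s => ?_
    obtain ⟨K, hK | hK⟩ := h (t s) (ht0 s) (ht1 s)
    · exact Set.mem_iUnion.2 ⟨(true, K), by simpa [hE] using hK⟩
    · exact Set.mem_iUnion.2 ⟨(false, K), by simpa [hE] using hK⟩
  have hdense := dense_iUnion_interior_of_closed hclosed hcover
  obtain ⟨s, hs, hsU⟩ := hdense.exists_mem_open isOpen_Ioo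
    (Set.nonempty_Ioo.2 (Real.log_lt_log hr₀ hr))
  obtain ⟨p, hp⟩ := Set.mem_iUnion.1 hs
  obtain ⟨ε, hε, hball⟩ := Metric.mem_nhds_iff.1
    ((isOpen_interior.inter isOpen_Ioo).mem_nhds ⟨hp, hsU⟩)
  have hin : ∀ u, |u - s| < ε → u ∈ E p ∧ Real.log r₀ < u ∧ u < Real.log r₁ := fun u hu => by
    have := hball (show u ∈ Metric.ball s ε by rwa [Metric.mem_ball, Real.dist_eq])
    exact ⟨interior_subset this.1, this.2⟩
  have habs : |s + ε / 2 - s| < ε := by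
    rw [add_sub_cancel_left, abs_of_pos (by positivity)]
    linarith
  refine ⟨Real.exp s, Real.exp (s + ε / 2), p.2, ?_, ?_, ?_, ?_⟩
  · rw [← Real.log_lt_iff_lt_exp hr₀]
    exact hsU.1
  · exact Real.exp_lt_exp.2 (by linarith)
  · rw [← Real.lt_log_iff_exp_lt (hr₀.trans hr)]
    exact (hin _ habs).2.2
  · have key : ∀ x y : ℕ, 1 ≤ y → p.2 < x → Real.exp s * y ≤ x →
        x ≤ Real.exp (s + ε / 2) * y → ∃ u, u ∈ E p ∧ p.2 < x + y ∧
        t u * ((x + y : ℕ) : ℝ) = x ∧ (1 - t u) * ((x + y : ℕ) : ℝ) = y := by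
      intro x y hy hx h1 h2
      have hy0 : (0 : ℝ) < y := by exact_mod_cast hy
      have hx0 : (0 : ℝ) < x := (mul_pos (Real.exp_pos s) hy0).trans_le h1
      have he : Real.exp (Real.log (x / y)) = x / y := Real.exp_log (div_pos hx0 hy0)
      refine ⟨Real.log (x / y), (hin _ ?_).1, by omega, ?_, ?_⟩
      · have h3 : s ≤ Real.log (x / y) := by
          rw [Real.le_log_iff_exp_le (div_pos hx0 hy0), le_div_iff₀ hy0]
          exact h1
        have h4 : Real.log (x / y) ≤ s + ε / 2 := by
          rw [Real.log_le_iff_le_exp (div_pos hx0 hy0), div_le_iff₀ hy0]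
          exact h2
        rw [abs_of_nonneg (by linarith)]
        linarith
      · simp only [ht, he]
        push_cast
        field_simp
        ring
      · simp only [ht, he]
        push_cast
        field_simp
        ring
    obtain ⟨b, K⟩ := p
    cases b
    · right
      intro x y hy hx h1 h2
      obtain ⟨u, hu, hK, e1, e2⟩ := key x y hy hx h1 h2
      simp only [hE, Bool.false_eq_true, if_false, Set.mem_iInter] at hu
      have := hu _ hK
      rw [Set.mem_ofPred_eq, e1, e2] at this
      exact this
    · left
      intro x y hy hx h1 h2
      obtain ⟨u, hu, hK, e1, e2⟩ := key x y hy hx h1 h2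
      simp only [hE, if_true, Set.mem_iInter] at hu
      have := hu _ hK
      rw [Set.mem_ofPred_eq, e1, e2] at this
      exact this

variable {A : ℕ}

/-- Shares `t / (A - 1)`, `(1 - t) / (A - 1)` and `1 / (A - 1)` for every other agent sum to `1`;
sizes `N = (A - 1) * n` then recover the planar ray exactly. -/
theorem exists_openSimplex_ray (hA : 2 ≤ A) {i j : Fin A} (hij : i ≠ j) {t : ℝ} (ht0 : 0 < t)
    (ht1 : t < 1) : ∃ χ ∈ openSimplex A, ∀ n : ℕ,
      χ i * (((A - 1) * n : ℕ) : ℝ) = t * n ∧ χ j * (((A - 1) * n : ℕ) : ℝ) = (1 - t) * n := by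
  have hA1 : (0 : ℝ) < ((A - 1 : ℕ) : ℝ) := by
    have : 0 < A - 1 := by omega
    exact_mod_cast this
  set χ : Fin A → ℝ := fun k =>
    (1 - (if k = i then 1 - t else 0) - (if k = j then t else 0)) / ((A - 1 : ℕ) : ℝ) with hχ
  have hpos : ∀ k, 0 < χ k := fun k => by
    refine div_pos ?_ hA1
    by_cases hki : k = i
    · have hkj : k ≠ j := fun h => hij (hki ▸ h)
      rw [if_pos hki, if_neg hkj]
      linarith
    · rw [if_neg hki]
      split_ifs <;> linarith
  refine ⟨χ, ⟨⟨fun k => (hpos k).le, ?_⟩, hpos⟩, fun n => ⟨?_, ?_⟩⟩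
  · simp only [hχ]
    rw [← Finset.sum_div, Finset.sum_sub_distrib, Finset.sum_sub_distrib]
    simp only [Finset.sum_ite_eq', Finset.mem_univ, if_true, Finset.sum_const, Finset.card_univ,
      Fintype.card_fin, nsmul_eq_mul, mul_one]
    rw [div_eq_one_iff_eq hA1.ne', Nat.cast_sub (by omega)]
    push_cast
    ring
  · simp only [hχ, if_true, if_neg hij]
    push_cast
    field_simp
    ring
  · simp only [hχ, if_true, if_neg hij.symm]
    push_cast
    field_simp
    ring

variable {F : Fin A → ℝ → ℝ}

/-- One index `K` serves both as starting point and as constant, so that countably many cases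
exhaust all rays although the constants depend on the ray. -/
theorem dichotomy_of_not_liminf_limsup (hA : 2 ≤ A) (hF : ∀ i x, 0 < x → 0 < F i x)
    {i j : Fin A} (hij : i ≠ j) (h : ∀ χ ∈ openSimplex A,
      ¬ (liminf (feedbackRatio F χ i j) atTop = 0 ∧ limsup (feedbackRatio F χ i j) atTop = ∞))
    {t : ℝ} (ht0 : 0 < t) (ht1 : t < 1) : ∃ K : ℕ,
      (∀ n : ℕ, K < n → F i (t * n) ≤ (K + 1 : ℝ) * F j ((1 - t) * n)) ∨
      (∀ n : ℕ, K < n → 1 / (K + 1 : ℝ) * F j ((1 - t) * n) ≤ F i (t * n)) := by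
  obtain ⟨χ, hχ, hray⟩ := exists_openSimplex_ray hA hij ht0 ht1
  have hle : ∀ n : ℕ, n ≤ (A - 1) * n := fun n => Nat.le_mul_of_pos_left n (by omega)
  have hposj : ∀ n : ℕ, 0 < n → 0 < F j ((1 - t) * n) := fun n hn =>
    hF j _ (mul_pos (by linarith) (by exact_mod_cast hn))
  rcases not_and_or.1 (h χ hχ) with h1 | h1
  · obtain ⟨c, hc0, hc⟩ := ENNReal.lt_iff_exists_nnreal_btwn.1 (pos_iff_ne_zero.2 h1)
    obtain ⟨N₀, hN₀⟩ := eventually_atTop.1 (eventually_lt_of_lt_liminf hc)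
    have hc0' : (0 : ℝ) < c := by exact_mod_cast hc0
    obtain ⟨K₁, hK₁⟩ := exists_nat_gt (1 / (c : ℝ))
    refine ⟨max N₀ K₁, Or.inr fun n hn => ?_⟩
    have h2 := hN₀ ((A - 1) * n) ((le_max_left _ _).trans (hn.le.trans (hle n)))
    have hp := hposj n (by omega)
    rw [feedbackRatio, (hray n).1, (hray n).2, ← ENNReal.ofReal_coe_nnreal] at h2
    have h3 := (lt_div_iff₀ hp).1 ((ENNReal.ofReal_lt_ofReal_iff_of_nonneg c.coe_nonneg).1 h2)
    refine le_trans (mul_le_mul_of_nonneg_right ?_ hp.le) h3.le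
    refine (one_div_le (by positivity) hc0').2 ?_
    have : (K₁ : ℝ) ≤ ((max N₀ K₁ : ℕ) : ℝ) := by exact_mod_cast le_max_right _ _
    linarith
  · obtain ⟨c, hc, -⟩ := ENNReal.lt_iff_exists_nnreal_btwn.1 (lt_top_iff_ne_top.2 h1)
    obtain ⟨N₀, hN₀⟩ := eventually_atTop.1 (eventually_lt_of_limsup_lt hc)
    obtain ⟨K₁, hK₁⟩ := exists_nat_gt (c : ℝ)
    refine ⟨max N₀ K₁, Or.inl fun n hn => ?_⟩
    have h2 := hN₀ ((A - 1) * n) ((le_max_left _ _).trans (hn.le.trans (hle n)))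
    have hp := hposj n (by omega)
    rw [feedbackRatio, (hray n).1, (hray n).2, ← ENNReal.ofReal_coe_nnreal] at h2
    have h2' := (ENNReal.ofReal_lt_ofReal_iff_of_nonneg (div_nonneg (hF i _ (by
      have : (0 : ℝ) < n := by exact_mod_cast (show 0 < n by omega)
      positivity)).le hp.le)).1 h2
    have h3 := (div_lt_iff₀ hp).1 h2'
    refine h3.le.trans (mul_le_mul_of_nonneg_right ?_ hp.le)
    have : (K₁ : ℝ) ≤ ((max N₀ K₁ : ℕ) : ℝ) := by exact_mod_cast le_max_right _ _
    linarith

/-- The limit is above `α` or below `β`; the gap between them makes one of the inequalities hold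
eventually. -/
theorem dichotomy_of_tendsto (hA : 2 ≤ A) (hF : ∀ i x, 0 < x → 0 < F i x)
    {i j : Fin A} (hij : i ≠ j) (h : ∀ χ ∈ openSimplex A,
      ∃ L : ℝ≥0∞, Tendsto (feedbackRatio F χ i j) atTop (𝓝 L))
    {α β : ℝ} (hα : 0 < α) (hαβ : α < β) {t : ℝ} (ht0 : 0 < t) (ht1 : t < 1) : ∃ K : ℕ,
      (∀ n : ℕ, K < n → F i (t * n) ≤ β * F j ((1 - t) * n)) ∨
      (∀ n : ℕ, K < n → α * F j ((1 - t) * n) ≤ F i (t * n)) := by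
  obtain ⟨χ, hχ, hray⟩ := exists_openSimplex_ray hA hij ht0 ht1
  have hle : ∀ n : ℕ, n ≤ (A - 1) * n := fun n => Nat.le_mul_of_pos_left n (by omega)
  have hposj : ∀ n : ℕ, 0 < n → 0 < F j ((1 - t) * n) := fun n hn =>
    hF j _ (mul_pos (by linarith) (by exact_mod_cast hn))
  obtain ⟨L, hL⟩ := h χ hχ
  rcases lt_or_ge (ENNReal.ofReal α) L with h1 | h1
  · obtain ⟨N₀, hN₀⟩ := eventually_atTop.1 (hL.eventually (lt_mem_nhds h1))
    refine ⟨N₀, Or.inr fun n hn => ?_⟩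
    have h2 := hN₀ ((A - 1) * n) (hn.le.trans (hle n))
    rw [feedbackRatio, (hray n).1, (hray n).2,
      ENNReal.ofReal_lt_ofReal_iff_of_nonneg hα.le] at h2
    exact ((lt_div_iff₀ (hposj n (by omega))).1 h2).le
  · have h1' : L < ENNReal.ofReal β :=
      h1.trans_lt ((ENNReal.ofReal_lt_ofReal_iff_of_nonneg hα.le).2 hαβ)
    obtain ⟨N₀, hN₀⟩ := eventually_atTop.1 (hL.eventually (gt_mem_nhds h1'))
    refine ⟨N₀, Or.inl fun n hn => ?_⟩
    have h2 := hN₀ ((A - 1) * n) (hn.le.trans (hle n))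
    rw [feedbackRatio, (hray n).1, (hray n).2] at h2
    have h2' := (ENNReal.ofReal_lt_ofReal_iff (hα.trans hαβ)).1 h2
    exact ((div_lt_iff₀ (hposj n (by omega))).1 h2').le

end Sectors

/-! ### Agents of type E -/

section Exponential

theorem exists_forall_le_of_limsup_lt_top {u : ℕ → ℝ}
    (h : limsup (fun k => ENNReal.ofReal (u k)) atTop < ∞) : ∃ C, 1 < C ∧ ∀ k, u k ≤ C := by
  obtain ⟨c, hc, -⟩ := ENNReal.lt_iff_exists_nnreal_btwn.1 h
  obtain ⟨K, hK⟩ := eventually_atTop.1 (eventually_lt_of_limsup_lt hc)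
  have hs : 0 ≤ ∑ k ∈ Finset.range K, |u k| := Finset.sum_nonneg fun _ _ => abs_nonneg _
  have hc0 : (0 : ℝ) ≤ c := c.coe_nonneg
  refine ⟨c + ∑ k ∈ Finset.range K, |u k| + 2, by linarith, fun k => ?_⟩
  rcases lt_or_ge k K with hk | hk
  · have h1 : |u k| ≤ ∑ k ∈ Finset.range K, |u k| :=
      Finset.single_le_sum (f := fun k => |u k|) (fun _ _ => abs_nonneg _)
        (Finset.mem_range.2 hk)
    have h2 := le_abs_self (u k)
    linarith
  · have h1 := hK k hk
    rw [← ENNReal.ofReal_coe_nnreal] at h1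
    have h2 : u k ≤ c := by
      by_contra hlt
      exact absurd h1 (not_lt.2 (ENNReal.ofReal_le_ofReal (not_le.1 hlt).le))
    linarith

variable {f g : ℝ → ℝ}

/-- The first summand of a tail is at least the fraction `1 / C` of it, so every step removes that
fraction. Taking `C > 1` keeps `q` positive. -/
theorem IsTypeE.exists_decay (h : IsTypeE f) (hf : ∀ x, 0 < x → 0 < f x) :
    ∃ C q : ℝ, 0 < C ∧ 0 < q ∧ q < 1 ∧ (∀ k : ℕ, f k * tailSum f k ≤ C) ∧
      ∀ k : ℕ, 1 ≤ k → ∀ m : ℕ, tailSum f (k + m) ≤ q ^ m * tailSum f k := by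
  obtain ⟨C, hC1, hC⟩ := exists_forall_le_of_limsup_lt_top h.2
  have hC0 : 0 < C := by linarith
  have hq : 0 < 1 - 1 / C := by
    rw [sub_pos, div_lt_one hC0]
    exact hC1
  refine ⟨C, 1 - 1 / C, hC0, hq, by linarith [one_div_pos.2 hC0], hC, fun k hk m => ?_⟩
  induction m with
  | zero => simp
  | succ m ih =>
    have h1 := tailSum_succ h.1 (k + m)
    have hp : 0 < f ((k + m : ℕ) : ℝ) := hf _ (by positivity)
    have h2 : tailSum f (k + m) * (1 / C) ≤ 1 / f ((k + m : ℕ) : ℝ) := by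
      have h3 := hC (k + m)
      rw [mul_one_div, div_le_div_iff₀ hC0 hp]
      linarith
    have h4 : tailSum f (k + (m + 1)) ≤ (1 - 1 / C) * tailSum f (k + m) := by
      rw [← add_assoc]
      linarith
    refine h4.trans ((mul_le_mul_of_nonneg_left ih hq.le).trans_eq ?_)
    ring

/-- `g y * ∑_{l ≥ x} 1 / f l → 0` in the region `ρ * y ≤ x`. -/
def ExpBeats (f g : ℝ → ℝ) (ρ : ℝ) : Prop :=
  ∀ ε : ℝ, 0 < ε → ∃ Y : ℕ, ∀ x y : ℕ, Y ≤ x → Y ≤ y → ρ * y ≤ x → g y * tailSum f x ≤ ε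

/-- Compare `f x` with `g y'` for `y'` near the edge `x / s₁` of the sector. Any `y` with `x ≤ s₀ *
y` lies at least `n` beyond `y'` for large arguments, and these `n` steps gain the factor `q ^ n`
over the bound `M * C`. -/
theorem IsTypeE.expBeats (hg : IsTypeE g) (hgpos : ∀ x, 0 < x → 0 < g x)
    {s₀ s₁ M : ℝ} {K : ℕ} (hs₀ : 0 < s₀) (hs : s₀ < s₁) (hM : 0 < M)
    (h : ∀ x y : ℕ, K < x → K < y → s₀ * y ≤ x → x ≤ s₁ * y → f x ≤ M * g y) :
    ExpBeats g f s₀⁻¹ := by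
  intro ε hε
  obtain ⟨C, q, hC, hq0, hq1, hbd, hdec⟩ := hg.exists_decay hgpos
  have hs₁ : 0 < s₁ := hs₀.trans hs
  obtain ⟨n, hn⟩ := exists_pow_lt_of_lt_one (show 0 < ε / (M * C) by positivity) hq1
  obtain ⟨Y₁, hY₁⟩ := exists_nat_gt (s₀ * s₁ / (s₁ - s₀))
  obtain ⟨Y₂, hY₂⟩ := exists_nat_gt ((n + 1 : ℝ) / (1 - s₀ / s₁))
  obtain ⟨Y₃, hY₃⟩ := exists_nat_gt (s₁ * (K + 1))
  refine ⟨Y₁ + Y₂ + Y₃ + K + 1, fun y x hy hx hyx => ?_⟩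
  rw [inv_mul_le_iff₀ hs₀] at hyx
  have hxR : (Y₁ : ℝ) + Y₂ + Y₃ + K + 1 ≤ x := by exact_mod_cast hx
  have hyR : (Y₁ : ℝ) + Y₂ + Y₃ + K + 1 ≤ y := by exact_mod_cast hy
  have p1 : (0 : ℝ) ≤ Y₁ := Nat.cast_nonneg _
  have p2 : (0 : ℝ) ≤ Y₂ := Nat.cast_nonneg _
  have p3 : (0 : ℝ) ≤ Y₃ := Nat.cast_nonneg _
  have p4 : (0 : ℝ) ≤ K := Nat.cast_nonneg _
  -- The smallest `y'` with `x ≤ s₁ * y'`. The size of `Y₁` puts it inside the sector despite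
  -- rounding, `Y₂` gives `y' + n ≤ y`, and `Y₃` gives `K < y'`.
  set y' : ℕ := ⌈(x : ℝ) / s₁⌉₊ with hy'
  have e1 : (x : ℝ) / s₁ ≤ y' := Nat.le_ceil _
  have e2 : (y' : ℝ) < x / s₁ + 1 := Nat.ceil_lt_add_one (by positivity)
  have e3 : (x : ℝ) ≤ s₁ * y' := by
    rw [div_le_iff₀ hs₁] at e1
    linarith
  have e4 : s₀ * y' ≤ x := by
    rw [div_lt_iff₀ (by linarith)] at hY₁
    have e5 : s₁ * y' < x + s₁ := by
      have := mul_lt_mul_of_pos_left e2 hs₁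
      rwa [mul_add, mul_div_cancel₀ _ hs₁.ne', mul_one] at this
    have e6 : s₀ * (s₁ * y') ≤ s₀ * (x + s₁) := mul_le_mul_of_nonneg_left e5.le hs₀.le
    have e7 : (Y₁ : ℝ) * (s₁ - s₀) ≤ x * (s₁ - s₀) :=
      mul_le_mul_of_nonneg_right (by linarith) (by linarith)
    have e8 : s₁ * (s₀ * y') ≤ s₁ * x := by nlinarith
    exact le_of_mul_le_mul_left e8 hs₁
  have e5 : K < y' := by
    have : (K : ℝ) + 1 ≤ x / s₁ := by
      rw [le_div_iff₀ hs₁]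
      linarith
    have : (K : ℝ) < y' := by linarith
    exact_mod_cast this
  have e6 : y' + n ≤ y := by
    have hlt : 0 < 1 - s₀ / s₁ := by
      rw [sub_pos, div_lt_one hs₁]
      exact hs
    rw [div_lt_iff₀ hlt] at hY₂
    have e7 : (x : ℝ) / s₁ ≤ s₀ / s₁ * y := by
      rw [div_mul_eq_mul_div]
      exact div_le_div_of_nonneg_right hyx hs₁.le
    have e8 : (Y₂ : ℝ) * (1 - s₀ / s₁) ≤ y * (1 - s₀ / s₁) :=
      mul_le_mul_of_nonneg_right (by linarith) hlt.le
    have : (y' : ℝ) + n ≤ y := by nlinarith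
    exact_mod_cast this
  have hgy : 0 < g y' := hgpos _ (by
    have : 0 < y' := by omega
    exact_mod_cast this)
  have hS : 0 ≤ tailSum g y := tailSum_nonneg hgpos (by omega)
  have t1 : tailSum g y ≤ q ^ n * tailSum g y' :=
    (tailSum_anti hg.1 hgpos (by omega) e6).trans (hdec y' (by omega) n)
  calc f x * tailSum g y ≤ M * g y' * tailSum g y :=
        mul_le_mul_of_nonneg_right (h x y' (by omega) e5 e4 e3) hS
    _ ≤ M * g y' * (q ^ n * tailSum g y') :=
        mul_le_mul_of_nonneg_left t1 (mul_pos hM hgy).le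
    _ = M * q ^ n * (g y' * tailSum g y') := by ring
    _ ≤ M * q ^ n * C := mul_le_mul_of_nonneg_left (hbd y') (by positivity)
    _ = q ^ n * (M * C) := by ring
    _ ≤ ε := by
      rw [lt_div_iff₀ (by positivity)] at hn
      exact hn.le

theorem MonopolyCondition.of_one_div_le_geometric (hf : ∀ x, 0 < x → 0 < f x) {D p : ℝ} {X : ℕ}
    (hp0 : 0 < p) (hp1 : p < 1) (h : ∀ x : ℕ, X ≤ x → 1 / f x ≤ D * p ^ x) :
    MonopolyCondition f := by
  refine (summable_nat_add_iff (f := fun k : ℕ => 1 / f (k : ℝ)) 1).2 ?_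
  refine (summable_nat_add_iff (f := fun k : ℕ => 1 / f (k : ℝ)) (X + 1)).1 ?_
  refine Summable.of_nonneg_of_le
    (fun n => one_div_nonneg.2 (hf _ (by positivity)).le) (fun n => h _ (by omega)) ?_
  exact ((summable_nat_add_iff (X + 1)).2 (summable_geometric_of_lt_one hp0.le hp1)).mul_left D

/-- For type P the tail sum eventually loses at most the fraction `(1 - p) / 2` per step, so it
decays no faster than `((1 + p) / 2) ^ n`. This contradicts the bound of order `p ^ n`, as `p < (1 +
p) / 2`. -/
theorem not_isTypeP_of_one_div_le_geometric (hf : ∀ x, 0 < x → 0 < f x) {D p : ℝ} {X : ℕ}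
    (hp0 : 0 < p) (hp1 : p < 1) (h : ∀ x : ℕ, X ≤ x → 1 / f x ≤ D * p ^ x) :
    ¬ IsTypeP f := by
  rintro ⟨hM, hP⟩
  obtain ⟨K₀, hK₀⟩ := eventually_atTop.1 (hP.eventually_ge_atTop (2 / (1 - p)))
  have h1p : 0 < 1 - p := by linarith
  set K := max (max K₀ X) 1 with hK
  have hK1 : 1 ≤ K := le_max_right _ _
  have hKX : X ≤ K := (le_max_right _ _).trans (le_max_left _ _)
  have hKK : K₀ ≤ K := (le_max_left _ _).trans (le_max_left _ _)
  have hlow : ∀ n : ℕ, ((1 + p) / 2) ^ n * tailSum f K ≤ tailSum f (K + n) := by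
    intro n
    induction n with
    | zero => simp
    | succ n ih =>
      have hfp : 0 < f ((K + n : ℕ) : ℝ) := hf _ (by positivity)
      have h2 := hK₀ (K + n) (by omega)
      have h3 := tailSum_succ hM (K + n)
      have h4 : 1 / f ((K + n : ℕ) : ℝ) ≤ (1 - p) / 2 * tailSum f (K + n) := by
        rw [div_le_iff₀ hfp]
        rw [div_le_iff₀ h1p] at h2
        linarith
      have h5 : (1 + p) / 2 * tailSum f (K + n) ≤ tailSum f (K + (n + 1)) := by
        rw [← add_assoc]
        linarith
      refine le_trans ?_ h5
      rw [pow_succ, mul_assoc, mul_comm ((1 + p) / 2), ← mul_assoc, mul_comm ((1 + p) / 2)]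
      exact mul_le_mul_of_nonneg_right ih (by linarith)
  have hup : ∀ n : ℕ, tailSum f (K + n) ≤ D * p ^ K * p ^ n * (1 - p)⁻¹ := by
    intro n
    have hg : Summable fun l : ℕ => D * p ^ K * p ^ n * p ^ l :=
      (summable_geometric_of_lt_one hp0.le hp1).mul_left _
    have h2 := (hM.summable_add (K + n)).tsum_le_tsum (fun l => (h _ (by omega)).trans_eq (by
      rw [pow_add, pow_add]
      ring)) hg
    rwa [tsum_mul_left, tsum_geometric_of_lt_one hp0.le hp1] at h2
  have hS := tailSum_pos hM hf hK1
  set R := (1 + p) / 2 / p with hR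
  have hR1 : 1 < R := by
    rw [hR, lt_div_iff₀ hp0]
    linarith
  obtain ⟨n, hn⟩ := pow_unbounded_of_one_lt (D * p ^ K * (1 - p)⁻¹ / tailSum f K) hR1
  rw [div_lt_iff₀ hS, hR, div_pow, div_mul_eq_mul_div, lt_div_iff₀ (by positivity)] at hn
  have := (hlow n).trans (hup n)
  linarith

/-- Each large `x` has a partner `y ≈ x / s₁` in the sector, so the exponential growth of `g` passes
to `f` at rate `q ^ (1 / s₁)`. -/
theorem exists_geometric_of_sector (hg : IsTypeE g) (hf : ∀ x, 0 < x → 0 < f x)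
    (hgpos : ∀ x, 0 < x → 0 < g x) {s₀ s₁ M : ℝ} {K : ℕ} (hs₀ : 0 < s₀) (hs : s₀ < s₁)
    (hM : 0 < M)
    (h : ∀ x y : ℕ, 1 ≤ y → K < x → s₀ * y ≤ x → x ≤ s₁ * y → g y ≤ M * f x) :
    ∃ D p : ℝ, ∃ X : ℕ, 0 < p ∧ p < 1 ∧ ∀ x : ℕ, X ≤ x → 1 / f x ≤ D * p ^ x := by
  obtain ⟨C, q, hC, hq0, hq1, -, hdec⟩ := hg.exists_decay hgpos
  have hs₁ : 0 < s₁ := hs₀.trans hs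
  obtain ⟨Y₁, hY₁⟩ := exists_nat_gt (s₀ * s₁ / (s₁ - s₀))
  refine ⟨M * (tailSum g 1 * q⁻¹), q ^ (1 / s₁), Y₁ + K + 1, Real.rpow_pos_of_pos hq0 _,
    Real.rpow_lt_one hq0.le hq1 (by positivity), fun x hx => ?_⟩
  have hxR : (Y₁ : ℝ) + K + 1 ≤ x := by exact_mod_cast hx
  have p1 : (0 : ℝ) ≤ Y₁ := Nat.cast_nonneg _
  have p4 : (0 : ℝ) ≤ K := Nat.cast_nonneg _
  have hx0 : (0 : ℝ) < x := by linarith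
  set y : ℕ := ⌈(x : ℝ) / s₁⌉₊ with hy
  have e1 : (x : ℝ) / s₁ ≤ y := Nat.le_ceil _
  have e2 : (y : ℝ) < x / s₁ + 1 := Nat.ceil_lt_add_one (by positivity)
  have hy1 : 1 ≤ y := Nat.ceil_pos.2 (by positivity)
  have e3 : (x : ℝ) ≤ s₁ * y := by
    have := (div_le_iff₀ hs₁).1 e1
    linarith
  have e4 : s₀ * y ≤ x := by
    rw [div_lt_iff₀ (by linarith)] at hY₁
    have e5 : s₁ * y < x + s₁ := by
      have := mul_lt_mul_of_pos_left e2 hs₁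
      rwa [mul_add, mul_div_cancel₀ _ hs₁.ne', mul_one] at this
    have e6 : s₀ * (s₁ * y) ≤ s₀ * (x + s₁) := mul_le_mul_of_nonneg_left e5.le hs₀.le
    have e7 : (Y₁ : ℝ) * (s₁ - s₀) ≤ x * (s₁ - s₀) :=
      mul_le_mul_of_nonneg_right (by linarith) (by linarith)
    have e8 : s₁ * (s₀ * y) ≤ s₁ * x := by nlinarith
    exact le_of_mul_le_mul_left e8 hs₁
  have hfx : 0 < f x := hf _ hx0
  have hy0 : (0 : ℝ) < y := by exact_mod_cast hy1
  have hgy : 0 < g y := hgpos _ hy0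
  have h1 := h x y hy1 (by omega) e4 e3
  have h2 : 1 / f x ≤ M * (1 / g y) := by
    rw [mul_one_div, div_le_div_iff₀ hfx hgy]
    linarith
  have h3 : tailSum g y ≤ q ^ (y - 1) * tailSum g 1 := by
    have := hdec 1 le_rfl (y - 1)
    rwa [Nat.add_sub_cancel' hy1] at this
  have h4 : q ^ y ≤ (q ^ (1 / s₁)) ^ x := by
    rw [← Real.rpow_natCast, ← Real.rpow_natCast, ← Real.rpow_mul hq0.le]
    refine Real.rpow_le_rpow_of_exponent_ge hq0 hq1.le ?_
    rw [one_div_mul_eq_div]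
    exact e1
  have h5 : q ^ (y - 1) = q⁻¹ * q ^ y := by
    obtain ⟨z, hz⟩ := Nat.exists_eq_add_of_le' hy1
    rw [hz, Nat.add_sub_cancel, pow_succ]
    field_simp
  have hS1 := tailSum_pos hg.1 hgpos (k := 1) le_rfl
  calc 1 / f x ≤ M * (1 / g y) := h2
    _ ≤ M * tailSum g y :=
      mul_le_mul_of_nonneg_left (one_div_le_tailSum hg.1 hgpos hy1) hM.le
    _ ≤ M * (q ^ (y - 1) * tailSum g 1) := mul_le_mul_of_nonneg_left h3 hM.le
    _ = M * (tailSum g 1 * q⁻¹) * q ^ y := by rw [h5]; ring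
    _ ≤ _ := mul_le_mul_of_nonneg_left h4 (by positivity)

variable {A : ℕ}

theorem eventually_mul_initialState_le {χ : Fin A → ℝ} (hχ : χ ∈ openSimplex A) {i j : Fin A}
    {ρ : ℝ} (hρ : 0 < ρ) (h : ρ * χ j < χ i) :
    ∀ᶠ N in atTop, ρ * (initialState χ N j : ℝ) ≤ initialState χ N i := by
  obtain ⟨N₀, hN₀⟩ := exists_nat_gt (1 / (χ i - ρ * χ j))
  filter_upwards [eventually_ge_atTop N₀] with N hN
  have hd : 0 < χ i - ρ * χ j := by linarith
  rw [div_lt_iff₀ hd] at hN₀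
  have hNR : (N₀ : ℝ) ≤ N := by exact_mod_cast hN
  have h1 : (initialState χ N j : ℝ) ≤ χ j * N :=
    Nat.floor_le (mul_nonneg (hχ.2 j).le (Nat.cast_nonneg _))
  have h2 : χ i * N < initialState χ N i + 1 := Nat.lt_floor_add_one _
  nlinarith [mul_le_mul_of_nonneg_left h1 hρ.le, mul_le_mul_of_nonneg_right hNR hd.le]

theorem ExpBeats.eventually_le {F : Fin A → ℝ → ℝ} {χ : Fin A → ℝ} (hχ : χ ∈ openSimplex A)
    {i j : Fin A} {ρ : ℝ} (hρ : 0 < ρ) (h : ρ * χ j < χ i) (hB : ExpBeats (F i) (F j) ρ) {ε : ℝ}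
    (hε : 0 < ε) : ∀ᶠ N in atTop,
      F j (initialState χ N j) * tailSum (F i) (initialState χ N i) ≤ ε := by
  obtain ⟨Y, hY⟩ := hB ε hε
  filter_upwards [(tendsto_initialState (hχ.2 i)).eventually_ge_atTop Y,
    (tendsto_initialState (hχ.2 j)).eventually_ge_atTop Y,
    eventually_mul_initialState_le hχ hρ h] with N h1 h2 h3
  exact hY _ _ h1 h2 h3

/-- If some agent is of type E, then the agents of type E dissect the simplex. -/
theorem dissection_of_exists_isTypeE (hA : 2 ≤ A) {F : Fin A → ℝ → ℝ}
    (hF : ∀ i, IsFeedbackFunction (F i))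
    (hPE : ∀ i, MonopolyCondition (F i) → IsTypeP (F i) ∨ IsTypeE (F i))
    (hE : ∃ i, IsTypeE (F i))
    (hratio : ∀ χ ∈ openSimplex A, ∀ i j,
      ¬ (liminf (feedbackRatio F χ i j) atTop = 0 ∧
        limsup (feedbackRatio F χ i j) atTop = ∞)) :
    ((∀ i, IsPolytope (closure (attractionDomain F i)) ∧
      intrinsicInterior ℝ (closure (attractionDomain F i)) ⊆ attractionDomain F i) ∧
    (⋃ i, closure (attractionDomain F i)) = stdSimplex ℝ (Fin A)) ∧
    ∀ i, ¬ MonopolyCondition (F i) → attractionDomain F i = ∅ := by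
  classical
  have hpos : ∀ i x, 0 < x → 0 < F i x := fun i => (hF i).pos
  have hc : ∀ i, ContinuousOn (F i) (Set.Ioi 0) := fun i => (hF i).contDiffOn.continuousOn
  have hsector := fun (i j : Fin A) (hij : i ≠ j) (r₀ r₁ : ℝ) (h₀ : 0 < r₀) (h₁ : r₀ < r₁) =>
    exists_sector_of_dichotomy (hc i) (hc j) (fun K => 1 / (K + 1 : ℝ)) (fun K => (K + 1 : ℝ))
      (fun t ht0 ht1 => dichotomy_of_not_liminf_limsup hA hpos hij
        (fun χ hχ => hratio χ hχ i j) ht0 ht1) h₀ h₁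
  have hinv : ∀ (K : ℕ) (a b : ℝ), 1 / (K + 1 : ℝ) * a ≤ b → a ≤ (K + 1 : ℝ) * b := by
    intro K a b hab
    rwa [one_div, inv_mul_le_iff₀ (by positivity)] at hab
  -- In a sector just above the ratio `χ i / χ j`, either `F i` is bounded by `F j`, and `j` wins at
  -- `χ`, or `F i` keeps up with `F j`. The latter forces exponential growth, hence (M) and not type
  -- P, so type E, which is excluded.
  have hnotE : ∀ χ ∈ openSimplex A, ∀ i j, ¬ IsTypeE (F i) → IsTypeE (F j) →
      Tendsto (fun N => urnLaw F (initialState χ N) (unboundedEvent i)) atTop (𝓝 0) := by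
    intro χ hχ i j hi hj
    have hij : i ≠ j := fun h => hi (h ▸ hj)
    have hr : 0 < χ i / χ j := div_pos (hχ.2 i) (hχ.2 j)
    obtain ⟨s₀, s₁, K, h₀, h₁, -, h | h⟩ :=
      hsector i j hij (χ i / χ j) (χ i / χ j + 1) hr (by linarith)
    · have hB : ExpBeats (F j) (F i) s₀⁻¹ := hj.expBeats (hpos j) (hr.trans h₀) h₁
        (M := K + 1) (by positivity) fun x y hx hy => h x y (by omega) hx
      refine tendsto_unboundedEvent_of_mul hpos (hχ.2 j) (hχ.2 i) hj.1 fun ε hε =>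
        hB.eventually_le hχ (inv_pos.2 (hr.trans h₀)) ?_ hε
      rw [inv_mul_lt_iff₀ (hr.trans h₀)]
      rwa [div_lt_iff₀ (hχ.2 j)] at h₀
    · obtain ⟨D, p, X, hp0, hp1, hgeo⟩ := exists_geometric_of_sector hj (hpos i) (hpos j)
        (hr.trans h₀) h₁ (M := K + 1) (by positivity)
        fun x y hy hx h1 h2 => hinv K _ _ (h x y hy hx h1 h2)
      rcases hPE i (.of_one_div_le_geometric (hpos i) hp0 hp1 hgeo) with hP | hE'
      · exact absurd hP (not_isTypeP_of_one_div_le_geometric (hpos i) hp0 hp1 hgeo)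
      · exact absurd hE' hi
  have hempty : ∀ i, ¬ IsTypeE (F i) → attractionDomain F i = ∅ := by
    intro i hi
    obtain ⟨j, hj⟩ := hE
    refine Set.eq_empty_of_forall_notMem fun χ hχ => ?_
    exact notMem_attractionDomain_of_tendsto hpos (hnotE χ hχ.1 i j hi hj) hχ
  have htend : ∀ χ ∈ openSimplex A, ∀ i j, IsTypeE (F i) → ∀ ρ, 0 < ρ → ρ * χ j < χ i →
      ExpBeats (F i) (F j) ρ →
      Tendsto (fun N => urnLaw F (initialState χ N) (unboundedEvent j)) atTop (𝓝 0) :=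
    fun χ hχ i j hi ρ hρ hlt hB =>
      tendsto_unboundedEvent_of_mul hpos (hχ.2 i) (hχ.2 j) hi.1 fun ε hε =>
        hB.eventually_le hχ hρ hlt hε
  have hmemW : ∀ i, i ∈ Finset.univ.filter (fun i => IsTypeE (F i)) ↔ IsTypeE (F i) :=
    fun i => by simp
  refine ⟨dissection (Finset.univ.filter fun i => IsTypeE (F i)) ?_
    (fun i j ρ => ExpBeats (F i) (F j) ρ) _ (fun i χ hχ => hχ.1) ?_ ?_ ?_ ?_ ?_, ?_⟩
  · obtain ⟨i, hi⟩ := hE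
    exact ⟨i, (hmemW i).2 hi⟩
  · exact fun i hi => hempty i fun h => hi ((hmemW i).2 h)
  · intro i hi j hj hij r₀ r₁ hr₀ hr
    rw [hmemW] at hi hj
    obtain ⟨s₀, s₁, K, h₀, h₁, h₂, h | h⟩ := hsector i j hij r₀ r₁ hr₀ hr
    · exact ⟨s₀, h₀, h₁.trans h₂, Or.inr (hj.expBeats (hpos j) (hr₀.trans h₀) h₁
        (M := K + 1) (by positivity) fun x y hx hy => h x y (by omega) hx)⟩
    · have hs₀ := hr₀.trans h₀
      have hs₁ := hs₀.trans h₁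
      refine ⟨s₁, h₀.trans h₁, h₂, Or.inl ?_⟩
      -- The same lemma with the agents exchanged: the sector has edges `s₁⁻¹ < s₀⁻¹` in the inverse
      -- ratio, so the threshold is `s₁`.
      have := hi.expBeats (f := F j) (hpos i) (inv_pos.2 hs₁) ((inv_lt_inv₀ hs₁ hs₀).2 h₁)
        (M := K + 1) (K := K) (by positivity) fun y x hy hx h1 h2 =>
          hinv K _ _ (h x y (by omega) hx ?_ ?_)
      · rwa [inv_inv] at this
      · rwa [← le_inv_mul_iff₀ hs₀]
      · rwa [inv_mul_le_iff₀ hs₁] at h1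
  · intro χ hχ
    -- The score is the tail sum: `F j * tailSum (F i) ≤ 1 / 2` gives `tailSum (F i) < 1 / F j ≤
    -- tailSum (F j)`.
    refine ⟨fun i N => tailSum (F i) (initialState χ N i), fun i hi j hj _ ρ hρ hlt hB => ?_⟩
    rw [hmemW] at hi hj
    filter_upwards [hB.eventually_le hχ hρ hlt one_half_pos,
      (tendsto_initialState (hχ.2 j)).eventually_ge_atTop 1] with N h1 h2
    have hp : 0 < F j (initialState χ N j) := hpos j _ (by exact_mod_cast h2)
    have h3 := one_div_le_tailSum hj.1 (hpos j) h2
    refine lt_of_lt_of_le ?_ h3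
    rw [lt_div_iff₀ hp]
    linarith
  · intro χ hχ i hi hB
    rw [hmemW] at hi
    refine mem_attractionDomain_of_tendsto hpos hχ fun j hji => ?_
    by_cases hj : IsTypeE (F j)
    · obtain ⟨ρ, hρ, hlt, hB⟩ := hB j ((hmemW j).2 hj) hji
      exact htend χ hχ i j hi ρ hρ hlt hB
    · exact hnotE χ hχ j i hj hi
  · intro χ hχ i hi j hj hji ρ hρ hlt hB
    rw [hmemW] at hj
    exact notMem_attractionDomain_of_tendsto hpos (htend χ hχ j i hj ρ hρ hlt hB)
  · exact fun i hi => hempty i fun h => hi h.1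

end Exponential

/-! ### Agents of type P with the growth bound -/

section Polynomial

variable {f g : ℝ → ℝ}

/-- For `k ≤ l < m` the growth bound gives `1 / f l ≥ tailSum f m / (C * m)`. There are `m - k ≥ δ /
(1 + δ) * m` such summands, so together they are at least `c * tailSum f m`. -/
theorem GrowthBound.exists_decay (h : GrowthBound f) (hM : MonopolyCondition f)
    (hf : ∀ x, 0 < x → 0 < f x) {δ : ℝ} (hδ : 0 < δ) :
    ∃ q : ℝ, 0 < q ∧ q < 1 ∧ ∀ k m : ℕ, 1 ≤ k → (1 + δ) * k ≤ m →
      tailSum f m ≤ q * tailSum f k := by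
  obtain ⟨C, hC1, hC⟩ := exists_forall_le_of_limsup_lt_top h
  have hC0 : 0 < C := by linarith
  set c := δ / ((1 + δ) * C) with hc
  have hc0 : 0 < c := by positivity
  refine ⟨(1 + c)⁻¹, by positivity, inv_lt_one_of_one_lt₀ (by linarith), fun k m hk hkm => ?_⟩
  have hk0 : (0 : ℝ) < k := by exact_mod_cast hk
  have hkmR : (k : ℝ) ≤ m := by nlinarith
  have hkm' : k ≤ m := by exact_mod_cast hkmR
  have hm0 : (0 : ℝ) < m := hk0.trans_le hkmR
  have hS : 0 ≤ tailSum f m := tailSum_nonneg hf (hk.trans hkm')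
  have hterm : ∀ l ∈ Finset.Ico k m, tailSum f m / (C * m) ≤ 1 / f (l : ℝ) := by
    intro l hl
    obtain ⟨h1, h2⟩ := Finset.mem_Ico.1 hl
    have hl1 : 1 ≤ l := hk.trans h1
    have hl0 : (0 : ℝ) < l := by exact_mod_cast hl1
    have hfl := hf l hl0
    have h3 := hC l
    have h4 : f l * tailSum f l ≤ C * l := by
      have : 1 / (l : ℝ) * f l * tailSum f l = f l * tailSum f l / l := by ring
      rwa [this, div_le_iff₀ hl0] at h3
    have h5 := tailSum_anti hM hf hl1 h2.le
    have h6 : (l : ℝ) ≤ m := by exact_mod_cast h2.le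
    rw [div_le_div_iff₀ (by positivity) hfl]
    nlinarith [mul_le_mul_of_nonneg_left h5 hfl.le, mul_le_mul_of_nonneg_left h6 hC0.le]
  have hsum := Finset.card_nsmul_le_sum _ _ _ hterm
  rw [Nat.card_Ico, nsmul_eq_mul, Nat.cast_sub hkm'] at hsum
  have heq := tailSum_eq_sum_Ico_add hM hkm'
  rw [le_inv_mul_iff₀ (by positivity)]
  have h7 : c * tailSum f m ≤ (m - k : ℝ) * (tailSum f m / (C * m)) := by
    have : c ≤ (m - k : ℝ) / (C * m) := by
      rw [hc, div_le_div_iff₀ (by positivity) (by positivity)]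
      nlinarith
    calc c * tailSum f m ≤ (m - k : ℝ) / (C * m) * tailSum f m :=
          mul_le_mul_of_nonneg_right this hS
      _ = _ := by ring
  linarith

/-- Comparison of tail sums by blocks: `p` summands of one series against `q` summands of the
other. -/
theorem mul_tailSum_le_of_blocks (hfM : MonopolyCondition f) (hgM : MonopolyCondition g)
    (hf : ∀ x, 0 < x → 0 < f x) (hg : ∀ x, 0 < x → 0 < g x) {p q m : ℕ} (hp : 1 ≤ p)
    (hq : 1 ≤ q) (hm : 1 ≤ m) {c : ℝ} (hc : 0 < c)
    (h : ∀ n k l : ℕ, m ≤ n → p * n ≤ k → k < p * (n + 1) → q * n ≤ l → l < q * (n + 1) →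
      c * g l ≤ f k) :
    q * c * tailSum f (p * m) ≤ p * tailSum g (q * m) := by
  -- Each of the `p` summands `c / f k` is at most each of the `q` summands `1 / g l`, so the two
  -- block sums compare after weighting by `q` and `p`.
  have hblock : ∀ n, m ≤ n → q * c * ∑ k ∈ Finset.Ico (p * n) (p * (n + 1)), 1 / f (k : ℝ) ≤
      p * ∑ l ∈ Finset.Ico (q * n) (q * (n + 1)), 1 / g (l : ℝ) := by
    intro n hn
    have hpn : 1 ≤ p * n := Nat.mul_pos hp (hm.trans hn)
    have hqn : 1 ≤ q * n := Nat.mul_pos hq (hm.trans hn)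
    have h1 : ∀ k ∈ Finset.Ico (p * n) (p * (n + 1)),
        q * c * (1 / f (k : ℝ)) ≤ ∑ l ∈ Finset.Ico (q * n) (q * (n + 1)), 1 / g (l : ℝ) := by
      intro k hk
      obtain ⟨hk1, hk2⟩ := Finset.mem_Ico.1 hk
      have hfk : 0 < f k := hf _ (by exact_mod_cast hpn.trans hk1)
      have h2 := Finset.card_nsmul_le_sum (Finset.Ico (q * n) (q * (n + 1)))
        (fun l : ℕ => 1 / g (l : ℝ)) (c * (1 / f (k : ℝ))) fun l hl => by
          obtain ⟨hl1, hl2⟩ := Finset.mem_Ico.1 hl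
          have hgl : 0 < g l := hg _ (by exact_mod_cast hqn.trans hl1)
          rw [mul_one_div, div_le_div_iff₀ hfk hgl]
          linarith [h n k l hn hk1 hk2 hl1 hl2]
      rw [Nat.card_Ico, show q * (n + 1) - q * n = q by rw [mul_add, mul_one]; omega,
        nsmul_eq_mul] at h2
      linarith
    have h3 := Finset.sum_le_card_nsmul _ _ _ h1
    rw [Nat.card_Ico, show p * (n + 1) - p * n = p by rw [mul_add, mul_one]; omega,
      nsmul_eq_mul, ← Finset.mul_sum] at h3
    exact h3
  have hind : ∀ d, q * c * ∑ k ∈ Finset.Ico (p * m) (p * (m + d)), 1 / f (k : ℝ) ≤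
      p * ∑ l ∈ Finset.Ico (q * m) (q * (m + d)), 1 / g (l : ℝ) := by
    intro d
    induction d with
    | zero => simp
    | succ d ih =>
      have h1 := hblock (m + d) (Nat.le_add_right m d)
      have h2 := Finset.sum_Ico_consecutive (fun k : ℕ => 1 / f (k : ℝ))
        (Nat.mul_le_mul_left p (Nat.le_add_right m d))
        (Nat.mul_le_mul_left p (Nat.le_succ (m + d)))
      have h3 := Finset.sum_Ico_consecutive (fun l : ℕ => 1 / g (l : ℝ))
        (Nat.mul_le_mul_left q (Nat.le_add_right m d))
        (Nat.mul_le_mul_left q (Nat.le_succ (m + d)))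
      rw [← add_assoc]
      calc _ = _ := by rw [← h2]
        _ ≤ _ := by
          rw [← h3, mul_add (q * c : ℝ), mul_add (p : ℝ)]
          exact add_le_add ih h1
  have hq0 : (0 : ℝ) < q := by exact_mod_cast hq
  by_contra hcon
  rw [not_le, ← div_lt_iff₀' (by positivity)] at hcon
  obtain ⟨m', hm'⟩ := exists_lt_sum_Ico hfM _ hcon
  rw [div_lt_iff₀' (by positivity)] at hm'
  have h4 : ∑ k ∈ Finset.Ico (p * m) m', 1 / f (k : ℝ) ≤
      ∑ k ∈ Finset.Ico (p * m) (p * (m + m')), 1 / f (k : ℝ) := by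
    refine Finset.sum_le_sum_of_subset_of_nonneg (Finset.Ico_subset_Ico_right ?_)
      fun k hk _ => one_div_nonneg.2 (hf _ ?_).le
    · nlinarith
    · have := (Finset.mem_Ico.1 hk).1
      have : 1 ≤ p * m := Nat.mul_pos hp hm
      exact_mod_cast (show 0 < k by omega)
  have h5 := mul_le_mul_of_nonneg_left h4 (show (0 : ℝ) ≤ q * c by positivity)
  have h6 := mul_le_mul_of_nonneg_left
    (sum_Ico_le_tailSum hgM hg (Nat.mul_pos hq hm) (q * (m + m'))) (Nat.cast_nonneg (α := ℝ) p)
  linarith [hind m']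

/-- The tail sum of `f` at `x` is smaller than the tail sum of `g` at `y` by a constant factor in
the region `ρ * y ≤ x`. -/
def TailBeats (f g : ℝ → ℝ) (ρ : ℝ) : Prop :=
  ∃ δ : ℝ, 0 < δ ∧ ∃ Y : ℕ, ∀ x y : ℕ, Y ≤ x → Y ≤ y → ρ * y ≤ x →
    tailSum f x ≤ (1 - δ) * tailSum g y

/-- Within a narrow sector around a rational slope `P / Q`, sum blocks of `P` values of `f` against
`Q` values of `g`. If `f ≤ a * g` there, then `tailSum g (Q * m) ≤ tailSum f (P * m)`. If `f ≥ (b' /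
κ) * g`, then `tailSum f (P * m) ≤ κ * tailSum g (Q * m)`. Moving out to slope `u` or `v` dilates
the argument of `f` by `1 + δ` and gains the factor `q`, which suffices in both cases since `q * κ <
1`. -/
theorem exists_tailBeats (hfc : ContinuousOn f (Set.Ioi 0)) (hgc : ContinuousOn g (Set.Ioi 0))
    (hfM : MonopolyCondition f) (hgM : MonopolyCondition g) (hf : ∀ x, 0 < x → 0 < f x)
    (hg : ∀ x, 0 < x → 0 < g x) (hgrowth : GrowthBound f)
    (hdich : ∀ α β : ℝ, 0 < α → α < β → ∀ t : ℝ, 0 < t → t < 1 → ∃ K : ℕ,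
      (∀ n : ℕ, K < n → f (t * n) ≤ β * g ((1 - t) * n)) ∨
      (∀ n : ℕ, K < n → α * g ((1 - t) * n) ≤ f (t * n)))
    {r₀ r₁ : ℝ} (hr₀ : 0 < r₀) (hr : r₀ < r₁) :
    ∃ ρ, r₀ < ρ ∧ ρ < r₁ ∧ (TailBeats f g ρ ∨ TailBeats g f ρ⁻¹) := by
  obtain ⟨u, hu₀, hu₁⟩ := exists_between hr
  obtain ⟨a, hua, ha₁⟩ := exists_between hu₁
  obtain ⟨b, hab, hb₁⟩ := exists_between ha₁
  obtain ⟨v, hbv, hv₁⟩ := exists_between hb₁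
  have hu : 0 < u := hr₀.trans hu₀
  have ha : 0 < a := hu.trans hua
  have hb : 0 < b := ha.trans hab
  obtain ⟨δ, hδ, hδu, hδb⟩ : ∃ δ : ℝ, 0 < δ ∧ (1 + δ) * u < a ∧ (1 + δ) * b < v := by
    refine ⟨min ((a - u) / (2 * u)) ((v - b) / (2 * b)),
      lt_min (div_pos (by linarith) (by positivity)) (div_pos (by linarith) (by positivity)),
      ?_, ?_⟩
    · have h1 := min_le_left ((a - u) / (2 * u)) ((v - b) / (2 * b))
      have h2 := mul_le_mul_of_nonneg_right h1 hu.le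
      have h3 : (a - u) / (2 * u) * u = (a - u) / 2 := by field_simp
      linarith
    · have h1 := min_le_right ((a - u) / (2 * u)) ((v - b) / (2 * b))
      have h2 := mul_le_mul_of_nonneg_right h1 hb.le
      have h3 : (v - b) / (2 * b) * b = (v - b) / 2 := by field_simp
      linarith
  obtain ⟨q, hq0, hq1, hdec⟩ := hgrowth.exists_decay hfM hf hδ
  obtain ⟨κ, hκ1, hκq⟩ := exists_between (one_lt_inv_iff₀.2 ⟨hq0, hq1⟩)
  have hκ0 : 0 < κ := one_pos.trans hκ1
  have hqκ : q * κ < 1 := by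
    have := mul_lt_mul_of_pos_left hκq hq0
    rwa [mul_inv_cancel₀ hq0.ne'] at this
  -- The sector is taken so narrow that `b' / κ < a`: the dichotomy needs its lower constant to be
  -- smaller than its upper one.
  obtain ⟨b', hab', hb'⟩ := exists_between
    (show a < min b (κ * a) from lt_min hab (by nlinarith))
  obtain ⟨hb'b, hb'κ⟩ := lt_min_iff.1 hb'
  have hb'0 : 0 < b' := ha.trans hab'
  have hαβ : b' / κ < a := by
    rw [div_lt_iff₀ hκ0]
    linarith
  have hα : 0 < b' / κ := by positivity
  obtain ⟨s₀, s₁, K, h₀, h₁, h₂, hsec⟩ := exists_sector_of_dichotomy hfc hgc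
    (fun _ => b' / κ) (fun _ => a) (hdich (b' / κ) a hα hαβ) ha hab'
  have hs₀ : 0 < s₀ := ha.trans h₀
  obtain ⟨r, hr1, hr2⟩ := exists_rat_btwn h₁
  have hrpos : 0 < r := by exact_mod_cast hs₀.trans hr1
  obtain ⟨P, hP⟩ := Int.eq_ofNat_of_zero_le (Rat.num_nonneg.2 hrpos.le)
  set Q := r.den with hQ
  have hQ1 : 1 ≤ Q := r.pos
  have hQ0 : (0 : ℝ) < Q := by exact_mod_cast hQ1
  have hrPQ : (r : ℝ) = P / Q := by
    rw [Rat.cast_def, hP]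
    simp [hQ]
  have hP0 : (0 : ℝ) < P := by
    have h1 : (0 : ℝ) < P / Q := hrPQ ▸ (hs₀.trans hr1)
    by_contra hc
    have := div_nonpos_of_nonpos_of_nonneg (not_lt.1 hc) hQ0.le
    linarith
  have hP1 : 1 ≤ P := by exact_mod_cast hP0
  rw [hrPQ] at hr1 hr2
  rw [lt_div_iff₀ hQ0] at hr1
  rw [div_lt_iff₀ hQ0] at hr2
  have haQ : a * Q < P := (mul_lt_mul_of_pos_right h₀ hQ0).trans hr1
  have hPb : (P : ℝ) < b' * Q := hr2.trans (mul_lt_mul_of_pos_right h₂ hQ0)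
  -- Since `s₀ < P / Q < s₁`, the product of the `n`-th blocks lies in the sector for large `n`;
  -- `m₁` and `m₂` handle its two edges.
  obtain ⟨m₁, hm₁⟩ := exists_nat_gt (s₀ * Q / (P - s₀ * Q))
  obtain ⟨m₂, hm₂⟩ := exists_nat_gt (P / (s₁ * Q - P))
  rw [div_lt_iff₀ (by linarith)] at hm₁ hm₂
  set m₀ := m₁ + m₂ + K + 1 with hm₀
  have hmatch : ∀ n k l : ℕ, m₀ ≤ n → P * n ≤ k → k < P * (n + 1) → Q * n ≤ l →
      l < Q * (n + 1) → 1 ≤ l ∧ K < k ∧ s₀ * l ≤ k ∧ k ≤ s₁ * l := by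
    intro n k l hn hk1 hk2 hl1 hl2
    have hnR : (m₁ : ℝ) + m₂ + K + 1 ≤ n := by exact_mod_cast hn
    have p1 : (0 : ℝ) ≤ m₁ := Nat.cast_nonneg _
    have p2 : (0 : ℝ) ≤ m₂ := Nat.cast_nonneg _
    have p3 : (0 : ℝ) ≤ K := Nat.cast_nonneg _
    have k1 : (P : ℝ) * n ≤ k := by exact_mod_cast hk1
    have k2 : (k : ℝ) ≤ P * (n + 1) := by exact_mod_cast hk2.le
    have l1 : (Q : ℝ) * n ≤ l := by exact_mod_cast hl1
    have l2 : (l : ℝ) ≤ Q * (n + 1) := by exact_mod_cast hl2.le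
    have hs₁ : 0 < s₁ := hs₀.trans h₁
    refine ⟨le_trans (Nat.mul_pos hQ1 (by omega)) hl1, ?_, ?_, ?_⟩
    · have : 1 * n ≤ P * n := Nat.mul_le_mul_right n hP1
      omega
    · have e1 := mul_le_mul_of_nonneg_left l2 hs₀.le
      have e2 : (m₁ : ℝ) * (P - s₀ * Q) ≤ n * (P - s₀ * Q) :=
        mul_le_mul_of_nonneg_right (by linarith) (by linarith)
      linarith
    · have e1 := mul_le_mul_of_nonneg_left l1 hs₁.le
      have e2 : (m₂ : ℝ) * (s₁ * Q - P) ≤ n * (s₁ * Q - P) :=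
        mul_le_mul_of_nonneg_right (by linarith) (by linarith)
      linarith
  rcases hsec with hsec | hsec
  · refine ⟨u, hu₀, hu₁, Or.inr ⟨1 - q, by linarith, ?_⟩⟩
    obtain ⟨Y₁, hY₁⟩ := exists_nat_gt (a * Q / (a - (1 + δ) * u))
    rw [div_lt_iff₀ (by linarith)] at hY₁
    refine ⟨Q * m₀ + Y₁ + 1, fun y x hy hx hyx => ?_⟩
    rw [inv_mul_le_iff₀ hu] at hyx
    -- Rounding down bounds the tail sum of `g` at `y` from above by that at `Q * m`.
    set m := y / Q with hm
    have e1 : Q * m ≤ y := Nat.mul_div_le y Q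
    have e2 : y < Q * (m + 1) := by
      have h1 := Nat.lt_div_mul_add (a := y) hQ1
      rw [mul_add, mul_one, mul_comm]
      exact h1
    have hmm : m₀ ≤ m := by
      rw [hm, Nat.le_div_iff_mul_le hQ1, mul_comm]
      omega
    have hm1 : 1 ≤ m := by omega
    have hblk := mul_tailSum_le_of_blocks hgM hfM hg hf hQ1 hP1 hm1 (c := 1 / a)
      (by positivity) fun n l k hn hl1 hl2 hk1 hk2 => by
        obtain ⟨g1, g2, g3, g4⟩ := hmatch n k l (hmm.trans hn) hk1 hk2 hl1 hl2
        rw [one_div, inv_mul_le_iff₀ ha]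
        exact hsec k l g1 g2 g3 g4
    have hSg := tailSum_pos hgM hg (k := Q * m) (Nat.mul_pos hQ1 hm1)
    have e3 : tailSum g (Q * m) ≤ tailSum f (P * m) := by
      have e4 : (Q : ℝ) ≤ P * (1 / a) := by
        rw [mul_one_div, le_div_iff₀ ha]
        linarith
      have e5 := mul_le_mul_of_nonneg_right e4 hSg.le
      exact le_of_mul_le_mul_left (e5.trans hblk) hQ0
    have e6 : (1 + δ) * (x : ℝ) ≤ ((P * m : ℕ) : ℝ) := by
      have e2R : (y : ℝ) < Q * (m + 1) := by exact_mod_cast e2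
      have hyR : (Y₁ : ℝ) ≤ y := by exact_mod_cast (show Y₁ ≤ y by omega)
      have hmR : (0 : ℝ) ≤ m := Nat.cast_nonneg _
      push_cast
      have t1 := mul_le_mul_of_nonneg_left hyx (show 0 ≤ 1 + δ by linarith)
      have t2 := mul_le_mul_of_nonneg_right haQ.le hmR
      have t3 := mul_le_mul_of_nonneg_left e2R.le ha.le
      have t4 := mul_le_mul_of_nonneg_right hyR (show 0 ≤ a - (1 + δ) * u by linarith)
      linarith
    have e7 := hdec x (P * m) (by omega) e6
    have e8 := tailSum_anti hgM hg (Nat.mul_pos hQ1 hm1) e1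
    rw [sub_sub_cancel]
    linarith
  · refine ⟨v, by linarith, hv₁, Or.inl ⟨1 - q * κ, by linarith, ?_⟩⟩
    obtain ⟨Y₁, hY₁⟩ := exists_nat_gt ((1 + δ) * b * Q / (v - (1 + δ) * b))
    rw [div_lt_iff₀ (by linarith)] at hY₁
    refine ⟨Q * m₀ + Y₁ + 1, fun x y hx hy hxy => ?_⟩
    -- Here a lower bound for the tail sum of `g` at `y` is needed, so `y` is rounded up.
    set m := y / Q + 1 with hm
    have e1 : Q * m ≤ y + Q := by
      have := Nat.mul_div_le y Q
      rw [hm, mul_add, mul_one]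
      omega
    have e2 : y ≤ Q * m := by
      have h1 := Nat.lt_div_mul_add (a := y) hQ1
      rw [hm, mul_add, mul_one, mul_comm]
      exact h1.le
    have hmm : m₀ ≤ m := by
      refine le_trans ?_ (Nat.le_succ _)
      rw [Nat.le_div_iff_mul_le hQ1, mul_comm]
      omega
    have hm1 : 1 ≤ m := by omega
    have hblk := mul_tailSum_le_of_blocks hfM hgM hf hg hP1 hQ1 hm1 hα
      fun n k l hn hk1 hk2 hl1 hl2 => by
        obtain ⟨g1, g2, g3, g4⟩ := hmatch n k l (hmm.trans hn) hk1 hk2 hl1 hl2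
        exact hsec k l g1 g2 g3 g4
    have hSf := tailSum_pos hfM hf (k := P * m) (Nat.mul_pos hP1 hm1)
    have e3 : tailSum f (P * m) ≤ κ * tailSum g (Q * m) := by
      have e4 : (P : ℝ) / κ ≤ Q * (b' / κ) := by
        rw [← mul_div_assoc]
        exact div_le_div_of_nonneg_right (by linarith) hκ0.le
      have e5 := (mul_le_mul_of_nonneg_right e4 hSf.le).trans hblk
      rw [div_mul_eq_mul_div, mul_div_assoc] at e5
      have e6 := le_of_mul_le_mul_left e5 hP0
      rw [div_le_iff₀ hκ0] at e6
      linarith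
    have e6 : (1 + δ) * ((P * m : ℕ) : ℝ) ≤ x := by
      have e1R : (Q : ℝ) * m ≤ y + Q := by exact_mod_cast e1
      have hyR : (Y₁ : ℝ) ≤ y := by exact_mod_cast (show Y₁ ≤ y by omega)
      have hmR : (0 : ℝ) ≤ m := Nat.cast_nonneg _
      push_cast
      have hPbQ : (P : ℝ) ≤ b * Q := hPb.le.trans (mul_le_mul_of_nonneg_right hb'b.le hQ0.le)
      have t2 := mul_le_mul_of_nonneg_right hPbQ hmR
      have t3 := mul_le_mul_of_nonneg_left e1R hb.le
      have t5 := mul_le_mul_of_nonneg_left (t2.trans ((mul_assoc _ _ _).trans_le t3))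
        (show 0 ≤ 1 + δ by linarith)
      have t4 := mul_le_mul_of_nonneg_right hyR (show 0 ≤ v - (1 + δ) * b by linarith)
      linarith
    have e7 := hdec (P * m) x (Nat.mul_pos hP1 hm1) e6
    have e8 := tailSum_anti hgM hg (show 1 ≤ y by omega) e2
    have e9 := mul_le_mul_of_nonneg_left (e3.trans (mul_le_mul_of_nonneg_left e8 hκ0.le)) hq0.le
    rw [sub_sub_cancel]
    linarith

variable {A : ℕ}

theorem TailBeats.eventually_le {F : Fin A → ℝ → ℝ} {χ : Fin A → ℝ} (hχ : χ ∈ openSimplex A)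
    {i j : Fin A} {ρ : ℝ} (hρ : 0 < ρ) (h : ρ * χ j < χ i) (hB : TailBeats (F i) (F j) ρ) :
    ∃ δ : ℝ, 0 < δ ∧ ∀ᶠ N in atTop, tailSum (F i) (initialState χ N i) ≤
      (1 - δ) * tailSum (F j) (initialState χ N j) := by
  obtain ⟨δ, hδ, Y, hY⟩ := hB
  refine ⟨δ, hδ, ?_⟩
  filter_upwards [(tendsto_initialState (hχ.2 i)).eventually_ge_atTop Y,
    (tendsto_initialState (hχ.2 j)).eventually_ge_atTop Y,
    eventually_mul_initialState_le hχ hρ h] with N h1 h2 h3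
  exact hY _ _ h1 h2 h3

/-- If all agents with the monopoly condition are of type P with the growth bound, then they
dissect the simplex. -/
theorem dissection_of_isTypeP (hA : 2 ≤ A) {F : Fin A → ℝ → ℝ}
    (hF : ∀ i, IsFeedbackFunction (F i)) (hM : ∃ i, MonopolyCondition (F i))
    (hP : ∀ i, MonopolyCondition (F i) → IsTypeP (F i))
    (hgrowth : ∀ i, IsTypeP (F i) → GrowthBound (F i))
    (hratio : ∀ χ ∈ openSimplex A, ∀ i j,
      ∃ L : ℝ≥0∞, Tendsto (feedbackRatio F χ i j) atTop (𝓝 L)) :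
    ((∀ i, IsPolytope (closure (attractionDomain F i)) ∧
      intrinsicInterior ℝ (closure (attractionDomain F i)) ⊆ attractionDomain F i) ∧
    (⋃ i, closure (attractionDomain F i)) = stdSimplex ℝ (Fin A)) ∧
    ∀ i, ¬ MonopolyCondition (F i) → attractionDomain F i = ∅ := by
  classical
  have hpos : ∀ i x, 0 < x → 0 < F i x := fun i => (hF i).pos
  have hc : ∀ i, ContinuousOn (F i) (Set.Ioi 0) := fun i => (hF i).contDiffOn.continuousOn
  have hempty : ∀ i, ¬ MonopolyCondition (F i) → attractionDomain F i = ∅ := by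
    intro i hi
    obtain ⟨j, hj⟩ := hM
    refine Set.eq_empty_of_forall_notMem fun χ hχ => ?_
    exact notMem_attractionDomain_of_tendsto hpos
      (tendsto_unboundedEvent_of_not_monopolyCondition hpos (hχ.1.2 j) (hχ.1.2 i) hj hi) hχ
  have htend : ∀ χ ∈ openSimplex A, ∀ i j, i ≠ j → MonopolyCondition (F i) →
      MonopolyCondition (F j) → ∀ ρ, 0 < ρ → ρ * χ j < χ i → TailBeats (F i) (F j) ρ →
      Tendsto (fun N => urnLaw F (initialState χ N) (unboundedEvent j)) atTop (𝓝 0) := by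
    intro χ hχ i j hij hi hj ρ hρ hlt hB
    obtain ⟨δ, hδ, h⟩ := hB.eventually_le hχ hρ hlt
    exact tendsto_unboundedEvent_of_tailSum_le hpos hij (hχ.2 i) (hχ.2 j) (hP i hi) (hP j hj)
      hδ h
  have hmemW : ∀ i, i ∈ Finset.univ.filter (fun i => MonopolyCondition (F i)) ↔
      MonopolyCondition (F i) := fun i => by simp
  refine ⟨dissection (Finset.univ.filter fun i => MonopolyCondition (F i)) ?_
    (fun i j ρ => TailBeats (F i) (F j) ρ) _ (fun i χ hχ => hχ.1) ?_ ?_ ?_ ?_ ?_, hempty⟩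
  · obtain ⟨i, hi⟩ := hM
    exact ⟨i, (hmemW i).2 hi⟩
  · exact fun i hi => hempty i fun h => hi ((hmemW i).2 h)
  · intro i hi j hj hij r₀ r₁ hr₀ hr
    rw [hmemW] at hi hj
    exact exists_tailBeats (hc i) (hc j) hi hj (hpos i) (hpos j) (hgrowth i (hP i hi))
      (fun α β hα hαβ t ht0 ht1 =>
        dichotomy_of_tendsto hA hpos hij (fun χ hχ => hratio χ hχ i j) hα hαβ ht0 ht1) hr₀ hr
  · intro χ hχ
    refine ⟨fun i N => tailSum (F i) (initialState χ N i), fun i hi j hj _ ρ hρ hlt hB => ?_⟩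
    rw [hmemW] at hi hj
    obtain ⟨δ, hδ, h⟩ := hB.eventually_le hχ hρ hlt
    filter_upwards [h, (tendsto_initialState (hχ.2 j)).eventually_ge_atTop 1] with N h1 h2
    have := mul_pos hδ (tailSum_pos hj (hpos j) h2)
    linarith
  · intro χ hχ i hi hB
    rw [hmemW] at hi
    refine mem_attractionDomain_of_tendsto hpos hχ fun j hji => ?_
    by_cases hj : MonopolyCondition (F j)
    · obtain ⟨ρ, hρ, hlt, hB⟩ := hB j ((hmemW j).2 hj) hji
      exact htend χ hχ i j hji.symm hi hj ρ hρ hlt hB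
    · exact tendsto_unboundedEvent_of_not_monopolyCondition hpos (hχ.2 i) (hχ.2 j) hi hj
  · intro χ hχ i hi j hj hji ρ hρ hlt hB
    rw [hmemW] at hi hj
    exact notMem_attractionDomain_of_tendsto hpos (htend χ hχ j i hji hj hi ρ hρ hlt hB)

end Polynomial

end PolyaUrn

theorem mainTheorem1 (A : ℕ) (hA : 2 ≤ A) (F : Fin A → ℝ → ℝ)
    (hF : ∀ i, PolyaUrn.IsFeedbackFunction (F i))
    (hM : ∃ i, PolyaUrn.MonopolyCondition (F i))
    (hPE : ∀ i, PolyaUrn.MonopolyCondition (F i) →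
      PolyaUrn.IsTypeP (F i) ∨ PolyaUrn.IsTypeE (F i))
    (hcond :
      ((∃ i, PolyaUrn.IsTypeE (F i)) ∧
        ∀ χ ∈ PolyaUrn.openSimplex A, ∀ i j,
          ¬ (liminf (PolyaUrn.feedbackRatio F χ i j) atTop = 0 ∧
              limsup (PolyaUrn.feedbackRatio F χ i j) atTop = ∞)) ∨
      ((∀ i, ¬ PolyaUrn.IsTypeE (F i)) ∧
        (∀ i, PolyaUrn.IsTypeP (F i) → PolyaUrn.GrowthBound (F i)) ∧
        ∀ χ ∈ PolyaUrn.openSimplex A, ∀ i j,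
          ∃ L : ℝ≥0∞, Tendsto (PolyaUrn.feedbackRatio F χ i j) atTop (𝓝 L))) :
    (∀ i, PolyaUrn.IsPolytope (closure (PolyaUrn.attractionDomain F i)) ∧
      intrinsicInterior ℝ (closure (PolyaUrn.attractionDomain F i)) ⊆
        PolyaUrn.attractionDomain F i) ∧
    (∀ i j, i ≠ j →
      Disjoint (PolyaUrn.attractionDomain F i) (PolyaUrn.attractionDomain F j)) ∧
    (⋃ i, closure (PolyaUrn.attractionDomain F i)) = stdSimplex ℝ (Fin A) ∧
    (∀ i, ¬ PolyaUrn.MonopolyCondition (F i) → PolyaUrn.attractionDomain F i = ∅) := by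
  have hpos : ∀ i x, 0 < x → 0 < F i x := fun i => (hF i).pos
  have hdis : ∀ i j, i ≠ j →
      Disjoint (PolyaUrn.attractionDomain F i) (PolyaUrn.attractionDomain F j) :=
    fun i j hij => PolyaUrn.disjoint_attractionDomain hpos hij
  rcases hcond with ⟨hE, hratio⟩ | ⟨hE, hgrowth, hratio⟩
  · obtain ⟨⟨h1, h2⟩, h3⟩ := PolyaUrn.dissection_of_exists_isTypeE hA hF hPE hE hratio
    exact ⟨h1, hdis, h2, h3⟩
  · obtain ⟨⟨h1, h2⟩, h3⟩ := PolyaUrn.dissection_of_isTypeP hA hF hM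
      (fun i hi => (hPE i hi).resolve_right (hE i)) hgrowth hratio
    exact ⟨h1, hdis, h2, h3⟩
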